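/- **Setting.** Let $S$, $A$, $\Theta$ be finite sets and let $\{(S,A,T(\theta,\cdot),R(\theta,\cdot),\gamma)\}_{\theta\in\Theta}$ be a collection of MDPs indexed by a hidden parameter $\theta$, with rewards $R(\theta,s,a)\in[0,1]$ and discount factor $0\le\gamma<1$. For a belief $b$ on $\Theta$ put $R(b,s,a)=\sum_\theta b(\theta)R(\theta,s,a)$ and $P(s'\mid b,s,a)=\sum_\theta b(\theta)T(\theta,s,a,s')$, and let $b_{s'}$ be the Bayes posterior of $b$ after the transition $(s,a,s')$. The optimal Bayesian value is the bounded solution of $$V^*(b,s)=\max_a\Big\{R(b,s,a)+\gamma\sum_{s'}P(s'\mid b,s,a)\,V^*(b_{s'},s')\Big\},$$ and the Bayesian value $V^{\pi}$ of a policy $\pi$ (which may use the past) is defined by the same recursion with $a$ chosen by $\pi$ in place of the maximum. The reward bonus is $$RB(b,s,a)=\beta\sum_{s'}P(s'\mid b,s,a)\,\|b_{s'}-b\|_1 .$$ **Sample complexity.** Fix a prior $b_0$ and $\kappa>0$. Let $\zeta(s,a)\ge 1$ be integers such that for every belief $b'$ obtained from $b_0$ by Bayes updates on a sequence of transitions (each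 of positive predictive probability) that samples $(s,a)$ more than $\zeta(s,a)$ times, $RB(b',s,a)<\kappa$. A pair is *known* once it has been visited more than $\zeta(s,a)$ times. **Algorithm.** Start with belief $b_0$ in a state $s_0$. At time $t$ take an action $a_t$ maximizing $\tilde Q^*(b_t,s_t,\cdot)$, the optimal action value of the internal reward MDP with transitions $P(\cdot\mid b_t,\cdot,\cdot)$ and rewards $R(b_t,s,a)+\min\{RB(b_t,s,a),\,1/(1-\gamma)\}$, in which $b_t$ is not updated. Then observe $s_{t+1}$; set $b_{t+1}=b_t$ if $(s_t,a_t)$ is known, and otherwise let $b_{t+1}$ be the Bayes posterior. Probabilities of runs refer to the belief dynamics: given the past, $s_{t+1}\sim P(\cdot\mid b_t,s_t,a_t)$. Let $\mathcal A_t$ be the policy of running the algorithm from its data at time $t$ onwards, and $V^{\mathcal A_t}(b_t,s_t)$ its Bayesian value at $(b_t,s_t)$. **Assumption 1.** For every belief $b$ obtained from $b_0$ by such updates, and for every further one-step posterior $b'$ of $b$ (of positive predictive probability), $RB(b',s,a)\le RB(b,s,a)$ for all $(s,a)$. **Theorem.** There are universal constants $C,K>0$ such that the following holds for every collection of MDPs,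 prior and initial state as above, every $\varepsilon>0$ with $\varepsilon(1-\gamma)<1$ and every $0<\delta\le\frac12$. Let $\beta\ge C\,\frac{|S|^2|A|}{(1-\gamma)^2}$, let $\kappa=\varepsilon(1-\gamma)$, and suppose that Assumption 1 holds. Then with probability at least $1-\delta$, $$V^{\mathcal A_t}(b_t,s_t)\ \ge\ V^*(b_t,s_t)-4\varepsilon$$ for all but at most $$K\cdot\frac{\sum_{s,a}\zeta(s,a)}{\varepsilon(1-\gamma)^3}\,\ln\frac1\delta\,\ln\frac1{\varepsilon(1-\gamma)}$$ time steps $t$. -/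

import Mathlib

open MeasureTheory

noncomputable section

/-- A finite-branching controlled system on a (possibly infinite) state space `X`: in state `x`,
action `a` earns `reward x a`, the outcome `s : S` occurs with probability `prob x a s`, and the
next state is `next x a s`. -/
structure ControlledMDP (X S A : Type*) where
  reward : X → A → ℝ
  prob : X → A → S → ℝ
  next : X → A → S → X

namespace ControlledMDP

variable {X S A : Type*} [Fintype S]

/-- Optimal expected discounted reward over `n` steps (value iteration from `0`). -/
def optValueN (D : ControlledMDP X S A) (γ : ℝ) : ℕ → X → ℝ
  | 0, _ => 0
  | n + 1, x => ⨆ a, (D.reward x a + γ * ∑ s, D.prob x a s * D.optValueN γ n (D.next x a s))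

/-- Optimal discounted value, i.e. the bounded solution of Bellman's optimality equation
`V x = max_a {reward x a + γ * ∑ s, prob x a s * V (next x a s)}`.  All rewards below are
nonnegative and bounded, so value iteration increases to it and the limit is a supremum. -/
def optValue (D : ControlledMDP X S A) (γ : ℝ) (x : X) : ℝ := ⨆ n, D.optValueN γ n x

/-- Expected discounted reward of the policy `π` over `n` steps. -/
def policyValueN (D : ControlledMDP X S A) (γ : ℝ) (π : X → A) : ℕ → X → ℝ
  | 0, _ => 0
  | n + 1, x => D.reward x (π x) +
      γ * ∑ s, D.prob x (π x) s * D.policyValueN γ π n (D.next x (π x) s)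

/-- Discounted value of the policy `π`, i.e. the bounded solution of Bellman's equation
`V x = reward x (π x) + γ * ∑ s, prob x (π x) s * V (next x (π x) s)` (again the limit of the
increasing sequence of finite-horizon values). -/
def policyValue (D : ControlledMDP X S A) (γ : ℝ) (π : X → A) (x : X) : ℝ :=
  ⨆ n, D.policyValueN γ π n x

end ControlledMDP

/-- A collection of MDPs with common states `S` and actions `A`, indexed by a hidden parameter
in `Θ`: transition probabilities `T θ s a s'` and rewards `R θ s a`. -/
structure MDPFamily (Θ S A : Type*) [Fintype S] where
  T : Θ → S → A → S → ℝ
  R : Θ → S → A → ℝ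
  T_nonneg : ∀ θ s a s', 0 ≤ T θ s a s'
  T_sum : ∀ θ s a, ∑ s', T θ s a s' = 1

namespace MDPFamily

variable {Θ S A : Type*} [Fintype Θ] [Fintype S]

/-- Mean transition function `P(s' | b, s, a)`. -/
def meanT (M : MDPFamily Θ S A) (b : Θ → ℝ) (s : S) (a : A) (s' : S) : ℝ :=
  ∑ θ, M.T θ s a s' * b θ

/-- Mean reward function `R(b, s, a)`. -/
def meanR (M : MDPFamily Θ S A) (b : Θ → ℝ) (s : S) (a : A) : ℝ :=
  ∑ θ, M.R θ s a * b θ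

/-- Bayes' rule: the posterior after observing the transition `(s, a, s')`.  It is only ever used
with weight `P(s' | b, s, a)`, or when that probability is positive. -/
def update (M : MDPFamily Θ S A) (b : Θ → ℝ) (s : S) (a : A) (s' : S) : Θ → ℝ :=
  fun θ => M.T θ s a s' * b θ / M.meanT b s a s'

/-- The reward bonus `RB(b, s, a)`: `β` times the expected `L₁` distance between the current and
the next belief. -/
def bonus (M : MDPFamily Θ S A) (β : ℝ) (b : Θ → ℝ) (s : S) (a : A) : ℝ :=
  β * ∑ s', M.meanT b s a s' * ∑ θ, |M.update b s a s' θ - b θ|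

/-- The Bayesian decision problem: states are pairs (belief, state), and the belief is updated by
Bayes' rule at every step. -/
def bayesMDP (M : MDPFamily Θ S A) : ControlledMDP ((Θ → ℝ) × S) S A where
  reward x a := M.meanR x.1 x.2 a
  prob x a s' := M.meanT x.1 x.2 a s'
  next x a s' := (M.update x.1 x.2 a s', s')

/-- The optimal Bayesian value function `V*(b, s)`. -/
def bayesOptValue (M : MDPFamily Θ S A) (γ : ℝ) (b : Θ → ℝ) (s : S) : ℝ :=
  M.bayesMDP.optValue γ (b, s)

/-- The internal reward `R̃(b, s, a)`: mean reward plus the reward bonus, the bonus being limited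
to `1 / (1 - γ)`. -/
def internalR (M : MDPFamily Θ S A) (γ β : ℝ) (b : Θ → ℝ) (s : S) (a : A) : ℝ :=
  M.meanR b s a + min (M.bonus β b s a) (1 / (1 - γ))

/-- The internal reward MDP at the belief `b`, which is not updated inside this MDP. -/
def internalMDP (M : MDPFamily Θ S A) (γ β : ℝ) (b : Θ → ℝ) : ControlledMDP S S A where
  reward s a := M.internalR γ β b s a
  prob s a s' := M.meanT b s a s'
  next _ _ s' := s'

/-- The action value `Q̃*(b, s, a)` of the internal reward MDP. -/
def internalQ (M : MDPFamily Θ S A) (γ β : ℝ) (b : Θ → ℝ) (s : S) (a : A) : ℝ :=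
  M.internalR γ β b s a +
    γ * ∑ s', M.meanT b s a s' * (M.internalMDP γ β b).optValue γ s'

/-- `act` is a greedy action choice `argmax_a Q̃*(b, s, a)` (ties broken arbitrarily). -/
def IsGreedy (M : MDPFamily Θ S A) (γ β : ℝ) (act : (Θ → ℝ) → S → A) : Prop :=
  ∀ b ∈ stdSimplex ℝ Θ, ∀ s a, M.internalQ γ β b s a ≤ M.internalQ γ β b s (act b s)

section Sampling

variable [DecidableEq S] [DecidableEq A]

/-- One more visit to `(s, a)`. -/
def countVisit (n : S → A → ℕ) (s : S) (a : A) : S → A → ℕ :=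
  fun s₁ a₁ => if s₁ = s ∧ a₁ = a then n s₁ a₁ + 1 else n s₁ a₁

/-- `M.Sampled b₀ n b`: the belief `b` can result from the prior `b₀` by Bayes updates on some
sequence of sampled transitions, in which each pair `(s, a)` is sampled `n s a` times. -/
inductive Sampled (M : MDPFamily Θ S A) (b₀ : Θ → ℝ) : (S → A → ℕ) → (Θ → ℝ) → Prop
  | start : Sampled M b₀ (fun _ _ => 0) b₀
  | sample {n : S → A → ℕ} {b : Θ → ℝ} (h : Sampled M b₀ n b) (s : S) (a : A) (s' : S)
      (hpos : 0 < M.meanT b s a s') : Sampled M b₀ (countVisit n s a) (M.update b s a s')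

/-- The reward bonus of every pair `(s, a)` never increases when the belief is updated. -/
def BonusMonotone (M : MDPFamily Θ S A) (β : ℝ) (b₀ : Θ → ℝ) : Prop :=
  ∀ n b, M.Sampled b₀ n b → ∀ s₁ a₁ s', 0 < M.meanT b s₁ a₁ s' →
    ∀ s a, M.bonus β (M.update b s₁ a₁ s') s a ≤ M.bonus β b s a

/-- `ζ` is a sample complexity function: once `(s, a)` has been sampled more than `ζ s a` times,
starting from the prior `b₀`, its reward bonus is less than `κ`. -/
def IsSampleComplexity (M : MDPFamily Θ S A) (β κ : ℝ) (b₀ : Θ → ℝ) (ζ : S → A → ℕ) : Prop :=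
  ∀ n b, M.Sampled b₀ n b → ∀ s a, ζ s a < n s a → M.bonus β b s a < κ

/-- What the algorithm carries along: its belief, the current state, and the visit counts. -/
structure Agent (Θ S A : Type*) where
  belief : Θ → ℝ
  state : S
  visits : S → A → ℕ

/-- One step of the algorithm, after action `a` led to `s'`: the belief is updated, unless the
pair (current state, `a`) is known, i.e. was visited more than `ζ` times. -/
def agentStep (M : MDPFamily Θ S A) (ζ : S → A → ℕ) (g : Agent Θ S A) (a : A) (s' : S) :
    Agent Θ S A where
  belief := if ζ g.state a < g.visits g.state a then g.belief
    else M.update g.belief g.state a s'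
  state := s'
  visits := countVisit g.visits g.state a

/-- The algorithm's data at time `t` when the states encountered are `x 0, x 1, …`. -/
def agentAt (M : MDPFamily Θ S A) (ζ : S → A → ℕ) (act : (Θ → ℝ) → S → A) (b₀ : Θ → ℝ)
    (x : ℕ → S) : ℕ → Agent Θ S A
  | 0 => ⟨b₀, x 0, fun _ _ => 0⟩
  | t + 1 =>
    let g := M.agentAt ζ act b₀ x t
    M.agentStep ζ g (act g.belief g.state) (x (t + 1))

/-- The Bayesian decision problem with the algorithm's data recorded alongside.  In a state
`(b, g)`, rewards and transitions are governed by the Bayesian belief `b`, always updated by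
Bayes' rule. -/
def evalMDP (M : MDPFamily Θ S A) (ζ : S → A → ℕ) :
    ControlledMDP ((Θ → ℝ) × Agent Θ S A) S A where
  reward x a := M.meanR x.1 x.2.state a
  prob x a s' := M.meanT x.1 x.2.state a s'
  next x a s' := (M.update x.1 x.2.state a s', M.agentStep ζ x.2 a s')

/-- `V^{𝒜_t}(b_t, s_t)`: the Bayesian value, at the algorithm's current belief and state, of
running the algorithm from its current data `g` onwards. -/
def algValue (M : MDPFamily Θ S A) (γ : ℝ) (ζ : S → A → ℕ) (act : (Θ → ℝ) → S → A)
    (g : Agent Θ S A) : ℝ :=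
  (M.evalMDP ζ).policyValue γ (fun x => act x.2.belief x.2.state) (g.belief, g)

/-- `X` is the random state sequence of a run of the algorithm from the prior `b₀` and state `s₀`:
given the past, the next state is distributed as `P(· | b_t, s_t, a_t)`. -/
structure IsRun (M : MDPFamily Θ S A) (ζ : S → A → ℕ) (act : (Θ → ℝ) → S → A) (b₀ : Θ → ℝ)
    (s₀ : S) {Ω : Type*} [MeasurableSpace Ω] (μ : Measure Ω) (X : ℕ → Ω → S) : Prop where
  measurable : ∀ t s, MeasurableSet {ω | X t ω = s}
  start : ∀ᵐ ω ∂μ, X 0 ω = s₀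
  law : ∀ (t : ℕ) (x : ℕ → S),
    μ.real {ω | ∀ k ≤ t + 1, X k ω = x k} = μ.real {ω | ∀ k ≤ t, X k ω = x k} *
      M.meanT (M.agentAt ζ act b₀ x t).belief (x t)
        (act (M.agentAt ζ act b₀ x t).belief (x t)) (x (t + 1))

/-- The time steps at which the algorithm's policy is not `4ε`-close to optimal, along the state
sequence `x`. -/
def badTimes (M : MDPFamily Θ S A) (γ ε : ℝ) (ζ : S → A → ℕ) (act : (Θ → ℝ) → S → A)
    (b₀ : Θ → ℝ) (x : ℕ → S) : Set ℕ :=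
  {t | ¬ M.bayesOptValue γ (M.agentAt ζ act b₀ x t).belief (x t) - 4 * ε ≤
      M.algValue γ ζ act (M.agentAt ζ act b₀ x t)}

end Sampling

end MDPFamily

end

/-! The loss at time `t` is bounded by the discounted chance of soon visiting a pair that is not yet
known. A potential argument then bounds how often that chance can be large.

Optimism. As a function of unnormalised beliefs, the optimal Bayesian value is positively
homogeneous and `1 / (1 - γ)`-Lipschitz in `L₁`. The value gained or lost through one Bayes update
is therefore at most the bonus, and the frozen internal MDP overestimates `V*`
(`bayes_optValueN_le_internal`).

Loss at one time. Let `τ` be the time of the first visit to an unknown pair and `W` the expectation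
of `γ ^ τ` (`escape`). Before `τ` the algorithm follows the greedy policy of one fixed internal MDP
with bonuses below `κ`. The bonuses contribute at most `κ / (1 - γ) = ε`, and everything after `τ`
at most `2 W / (1 - γ) ^ 2` (`internal_optValue_le_knownValueN`). The true Bayesian belief keeps
moving while the algorithm's is frozen, but small bonuses mean small expected drift, which costs
another `ε` (`knownValueN_le_eval_policyValueN`). Hence `V* ≤ V^𝒜 + 2 ε + 2 W / (1 - γ) ^ 2`, so a
bad time has `W ≥ ε (1 - γ) ^ 2`.

Counting. The potential (twice the number of pending visits, minus `W`) is nonnegative and decreases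
in mean by at least `(1 - γ) W` per step, hence by `q = ε (1 - γ) ^ 3` at bad times
(`sum_meanT_mul_escapePotential_le`). An exponential supermartingale turns this into a geometric
tail for the number of bad times (`measureReal_countAgents_mul_le`), which gives order `(∑ ζ / q)
log (1 / δ)` bad times with probability `1 - δ`. -/

namespace ControlledMDP

/-! ### Range of the finite-horizon values -/

variable {X S A : Type*} [Fintype S]

theorem policyValueN_mem_Icc (D : ControlledMDP X S A) {γ ρ : ℝ} (hγ0 : 0 ≤ γ) (hγ1 : γ < 1)
    (I : Set X) (hρ : 0 ≤ ρ) (hr : ∀ x ∈ I, ∀ a, D.reward x a ∈ Set.Icc 0 ρ)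
    (hp : ∀ x ∈ I, ∀ a s, 0 ≤ D.prob x a s) (hp1 : ∀ x ∈ I, ∀ a, ∑ s, D.prob x a s ≤ 1)
    (hn : ∀ x ∈ I, ∀ a s, D.next x a s ∈ I) (π : X → A) (n : ℕ) :
    ∀ x ∈ I, D.policyValueN γ π n x ∈ Set.Icc 0 (ρ / (1 - γ)) := by
  have h1 : 0 < 1 - γ := by linarith
  induction n with
  | zero => intro x _; exact ⟨le_rfl, by simp only [policyValueN]; positivity⟩
  | succ n ih =>
    intro x hx
    simp only [policyValueN]
    have h0 : 0 ≤ ∑ s, D.prob x (π x) s * D.policyValueN γ π n (D.next x (π x) s) :=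
      Finset.sum_nonneg fun s _ => mul_nonneg (hp x hx _ s) (ih _ (hn x hx _ s)).1
    have h2 : ∑ s, D.prob x (π x) s * D.policyValueN γ π n (D.next x (π x) s) ≤ ρ / (1 - γ) := by
      calc _ ≤ ∑ s, D.prob x (π x) s * (ρ / (1 - γ)) :=
            Finset.sum_le_sum fun s _ => mul_le_mul_of_nonneg_left (ih _ (hn x hx _ s)).2
              (hp x hx _ s)
        _ = (∑ s, D.prob x (π x) s) * (ρ / (1 - γ)) := by rw [Finset.sum_mul]
        _ ≤ 1 * (ρ / (1 - γ)) := mul_le_mul_of_nonneg_right (hp1 x hx _) (by positivity)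
        _ = _ := one_mul _
    have h3 : ρ + γ * (ρ / (1 - γ)) = ρ / (1 - γ) := by field_simp; ring
    have hr' := hr x hx (π x)
    refine ⟨add_nonneg hr'.1 (mul_nonneg hγ0 h0), ?_⟩
    have := mul_le_mul_of_nonneg_left h2 hγ0
    linarith [hr'.2]

theorem optValueN_mem_Icc [Finite A] [Nonempty A] (D : ControlledMDP X S A) {γ ρ : ℝ}
    (hγ0 : 0 ≤ γ) (hγ1 : γ < 1)
    (I : Set X) (hρ : 0 ≤ ρ) (hr : ∀ x ∈ I, ∀ a, D.reward x a ∈ Set.Icc 0 ρ)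
    (hp : ∀ x ∈ I, ∀ a s, 0 ≤ D.prob x a s) (hp1 : ∀ x ∈ I, ∀ a, ∑ s, D.prob x a s ≤ 1)
    (hn : ∀ x ∈ I, ∀ a s, D.next x a s ∈ I) (n : ℕ) :
    ∀ x ∈ I, D.optValueN γ n x ∈ Set.Icc 0 (ρ / (1 - γ)) := by
  have h1 : 0 < 1 - γ := by linarith
  induction n with
  | zero => intro x _; exact ⟨le_rfl, by simp only [optValueN]; positivity⟩
  | succ n ih =>
    intro x hx
    have key : ∀ a, D.reward x a + γ * ∑ s, D.prob x a s * D.optValueN γ n (D.next x a s)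
        ∈ Set.Icc 0 (ρ / (1 - γ)) := by
      intro a
      have h0 : 0 ≤ ∑ s, D.prob x a s * D.optValueN γ n (D.next x a s) :=
        Finset.sum_nonneg fun s _ => mul_nonneg (hp x hx _ s) (ih _ (hn x hx _ s)).1
      have h2 : ∑ s, D.prob x a s * D.optValueN γ n (D.next x a s) ≤ ρ / (1 - γ) := by
        calc _ ≤ ∑ s, D.prob x a s * (ρ / (1 - γ)) :=
              Finset.sum_le_sum fun s _ => mul_le_mul_of_nonneg_left (ih _ (hn x hx _ s)).2
                (hp x hx _ s)
          _ = (∑ s, D.prob x a s) * (ρ / (1 - γ)) := by rw [Finset.sum_mul]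
          _ ≤ 1 * (ρ / (1 - γ)) := mul_le_mul_of_nonneg_right (hp1 x hx _) (by positivity)
          _ = _ := one_mul _
      have h3 : ρ + γ * (ρ / (1 - γ)) = ρ / (1 - γ) := by field_simp; ring
      have hr' := hr x hx a
      refine ⟨add_nonneg hr'.1 (mul_nonneg hγ0 h0), ?_⟩
      have := mul_le_mul_of_nonneg_left h2 hγ0
      linarith [hr'.2]
    simp only [optValueN]
    exact ⟨Real.iSup_nonneg fun a => (key a).1, ciSup_le fun a => (key a).2⟩

theorem le_optValueN_succ [Finite A] (D : ControlledMDP X S A) (γ : ℝ) (n : ℕ) (x : X) (a : A) :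
    D.reward x a + γ * ∑ s, D.prob x a s * D.optValueN γ n (D.next x a s)
      ≤ D.optValueN γ (n + 1) x := by
  rw [optValueN]
  exact le_ciSup (f := fun a => D.reward x a +
    γ * ∑ s, D.prob x a s * D.optValueN γ n (D.next x a s)) (Set.finite_range _).bddAbove a

end ControlledMDP

/-! ### Beliefs, mean transitions and Bayes' rule -/

namespace MDPFamily

variable {Θ S A : Type*} [Fintype Θ] [Fintype S]

/-- Nonnegative vectors of total mass at most one; unlike `stdSimplex`, this set is preserved by
`MDPFamily.update` even along transitions of probability zero. -/
def subbeliefs (Θ : Type*) [Fintype Θ] : Set (Θ → ℝ) := {b | (∀ θ, 0 ≤ b θ) ∧ ∑ θ, b θ ≤ 1}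

theorem stdSimplex_subset_subbeliefs : stdSimplex ℝ Θ ⊆ subbeliefs Θ :=
  fun _ hb => ⟨hb.1, hb.2.le⟩

theorem meanT_nonneg (M : MDPFamily Θ S A) {b : Θ → ℝ} (hb : ∀ θ, 0 ≤ b θ) (s : S) (a : A)
    (s' : S) : 0 ≤ M.meanT b s a s' :=
  Finset.sum_nonneg fun θ _ => mul_nonneg (M.T_nonneg θ s a s') (hb θ)

theorem sum_T_mul (M : MDPFamily Θ S A) (f : Θ → ℝ) (s : S) (a : A) :
    ∑ s', ∑ θ, M.T θ s a s' * f θ = ∑ θ, f θ := by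
  rw [Finset.sum_comm]
  refine Finset.sum_congr rfl fun θ _ => ?_
  rw [← Finset.sum_mul, M.T_sum, one_mul]

theorem sum_meanT (M : MDPFamily Θ S A) (b : Θ → ℝ) (s : S) (a : A) :
    ∑ s', M.meanT b s a s' = ∑ θ, b θ := M.sum_T_mul b s a

theorem meanR_mem_Icc (M : MDPFamily Θ S A) (hR : ∀ θ s a, M.R θ s a ∈ Set.Icc (0 : ℝ) 1)
    {b : Θ → ℝ} (hb : b ∈ subbeliefs Θ) (s : S) (a : A) : M.meanR b s a ∈ Set.Icc (0 : ℝ) 1 := by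
  refine ⟨Finset.sum_nonneg fun θ _ => mul_nonneg (hR θ s a).1 (hb.1 θ), le_trans ?_ hb.2⟩
  exact Finset.sum_le_sum fun θ _ => mul_le_of_le_one_left (hb.1 θ) (hR θ s a).2

theorem sum_meanT_mul_le (M : MDPFamily Θ S A) {b : Θ → ℝ} (hb : b ∈ subbeliefs Θ) (s : S)
    (a : A) {f : S → ℝ} {c : ℝ} (hc : 0 ≤ c) (hf : ∀ s', f s' ≤ c) :
    ∑ s', M.meanT b s a s' * f s' ≤ c := by
  calc _ ≤ ∑ s', M.meanT b s a s' * c :=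
        Finset.sum_le_sum fun s' _ => mul_le_mul_of_nonneg_left (hf s') (M.meanT_nonneg hb.1 s a s')
    _ = (∑ s', M.meanT b s a s') * c := by rw [Finset.sum_mul]
    _ ≤ c := mul_le_of_le_one_left hc ((M.sum_meanT b s a).le.trans hb.2)

theorem sum_meanT_mul_nonneg (M : MDPFamily Θ S A) {b : Θ → ℝ} (hb : b ∈ subbeliefs Θ) (s : S)
    (a : A) {f : S → ℝ} (hf : ∀ s', 0 ≤ f s') : 0 ≤ ∑ s', M.meanT b s a s' * f s' :=
  Finset.sum_nonneg fun s' _ => mul_nonneg (M.meanT_nonneg hb.1 s a s') (hf s')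

theorem meanR_sub_le (M : MDPFamily Θ S A) (hR : ∀ θ s a, M.R θ s a ∈ Set.Icc (0 : ℝ) 1)
    (b c : Θ → ℝ) (s : S) (a : A) : M.meanR b s a - M.meanR c s a ≤ ∑ θ, |b θ - c θ| := by
  rw [meanR, meanR, ← Finset.sum_sub_distrib]
  refine Finset.sum_le_sum fun θ _ => ?_
  rw [← mul_sub]
  calc _ ≤ M.R θ s a * |b θ - c θ| := mul_le_mul_of_nonneg_left (le_abs_self _) (hR θ s a).1
    _ ≤ _ := mul_le_of_le_one_left (abs_nonneg _) (hR θ s a).2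

theorem sum_abs_meanT_sub_le (M : MDPFamily Θ S A) (b c : Θ → ℝ) (s : S) (a : A) :
    ∑ s', |M.meanT b s a s' - M.meanT c s a s'| ≤ ∑ θ, |b θ - c θ| := by
  rw [← M.sum_T_mul (fun θ => |b θ - c θ|) s a]
  refine Finset.sum_le_sum fun s' _ => ?_
  rw [meanT, meanT, ← Finset.sum_sub_distrib]
  refine (Finset.abs_sum_le_sum_abs _ _).trans (Finset.sum_le_sum fun θ _ => ?_)
  rw [← mul_sub, abs_mul, abs_of_nonneg (M.T_nonneg θ s a s')]

theorem update_mem_stdSimplex (M : MDPFamily Θ S A) {b : Θ → ℝ} (hb : ∀ θ, 0 ≤ b θ) {s : S}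
    {a : A} {s' : S} (h : 0 < M.meanT b s a s') : M.update b s a s' ∈ stdSimplex ℝ Θ := by
  refine ⟨fun θ => div_nonneg (mul_nonneg (M.T_nonneg θ s a s') (hb θ)) h.le, ?_⟩
  simp only [update]
  rw [← Finset.sum_div]
  exact div_self h.ne'

theorem update_mem_subbeliefs (M : MDPFamily Θ S A) {b : Θ → ℝ} (hb : ∀ θ, 0 ≤ b θ) (s : S)
    (a : A) (s' : S) : M.update b s a s' ∈ subbeliefs Θ := by
  rcases (M.meanT_nonneg hb s a s').eq_or_lt with h | h
  -- Division by zero returns zero, so an impossible observation yields the zero vector.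
  · have : M.update b s a s' = 0 := by ext θ; simp [update, ← h]
    rw [this]
    exact ⟨fun _ => le_rfl, by simp⟩
  · exact stdSimplex_subset_subbeliefs (M.update_mem_stdSimplex hb h)

/-! ### The optimal Bayesian value -/

/-- The posterior does not see the scale of the belief, while mean rewards and predictive weights
are linear in it. One unfolding therefore suffices, without induction. -/
theorem bayes_optValueN_smul (M : MDPFamily Θ S A) (γ : ℝ) (n : ℕ) {c : ℝ} (hc : 0 < c)
    (b : Θ → ℝ) (s : S) :
    M.bayesMDP.optValueN γ n (c • b, s) = c * M.bayesMDP.optValueN γ n (b, s) := by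
  cases n with
  | zero => simp [ControlledMDP.optValueN]
  | succ n =>
    have hT : ∀ s a s', M.meanT (c • b) s a s' = c * M.meanT b s a s' := fun s a s' => by
      simp only [meanT, Finset.mul_sum, Pi.smul_apply, smul_eq_mul]
      exact Finset.sum_congr rfl fun θ _ => by ring
    have hU : ∀ s a s', M.update (c • b) s a s' = M.update b s a s' := fun s a s' => by
      ext θ
      simp only [update, hT, Pi.smul_apply, smul_eq_mul]
      rw [mul_left_comm, mul_div_mul_left _ _ hc.ne']
    have hm : ∀ s a, M.meanR (c • b) s a = c * M.meanR b s a := fun s a => by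
      simp only [meanR, Finset.mul_sum, Pi.smul_apply, smul_eq_mul]
      exact Finset.sum_congr rfl fun θ _ => by ring
    simp only [ControlledMDP.optValueN, bayesMDP, hT, hU, hm]
    rw [Real.mul_iSup_of_nonneg hc.le]
    congr 1
    ext a
    simp only [Finset.mul_sum, mul_add]
    congr 1
    exact Finset.sum_congr rfl fun s' _ => by ring

theorem bayes_optValueN_zero (M : MDPFamily Θ S A) (γ : ℝ) (n : ℕ) (s : S) :
    M.bayesMDP.optValueN γ n (0, s) = 0 := by
  cases n with
  | zero => rfl
  | succ n => simp [ControlledMDP.optValueN, bayesMDP, meanR, meanT]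

/-- Homogeneity absorbs the predictive probability into the belief and cancels the normalisation in
Bayes' rule, which is not itself Lipschitz. -/
theorem meanT_mul_bayes_optValueN (M : MDPFamily Θ S A) (γ : ℝ) (n : ℕ) {b : Θ → ℝ}
    (hb : ∀ θ, 0 ≤ b θ) (s : S) (a : A) (s' : S) :
    M.meanT b s a s' * M.bayesMDP.optValueN γ n (M.update b s a s', s') =
      M.bayesMDP.optValueN γ n (fun θ => M.T θ s a s' * b θ, s') := by
  rcases (M.meanT_nonneg hb s a s').eq_or_lt with h | h
  · have h0 : (fun θ => M.T θ s a s' * b θ) = 0 := by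
      ext θ
      exact (Finset.sum_eq_zero_iff_of_nonneg
        fun θ _ => mul_nonneg (M.T_nonneg θ s a s') (hb θ)).1 h.symm θ (Finset.mem_univ θ)
    rw [h0, ← h, zero_mul, bayes_optValueN_zero]
  · rw [← M.bayes_optValueN_smul γ n h]
    congr 2
    ext θ
    simp only [Pi.smul_apply, smul_eq_mul, update]
    exact mul_div_cancel₀ _ h.ne'

/-- With the weights absorbed, the posteriors are `T θ s a s' * b θ`. Their `L₁` distances add up
over `s'` to the original distance because `T` has row sums one, so each step adds one discounted
copy of that distance. -/
theorem bayes_optValueN_sub_le [Finite A] [Nonempty A] (M : MDPFamily Θ S A)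
    (hR : ∀ θ s a, M.R θ s a ∈ Set.Icc (0 : ℝ) 1) {γ : ℝ} (hγ0 : 0 ≤ γ) (hγ1 : γ < 1) (n : ℕ) :
    ∀ {b c : Θ → ℝ}, (∀ θ, 0 ≤ b θ) → (∀ θ, 0 ≤ c θ) → ∀ s,
      M.bayesMDP.optValueN γ n (b, s) ≤
        M.bayesMDP.optValueN γ n (c, s) + (∑ θ, |b θ - c θ|) / (1 - γ) := by
  have h1 : 0 < 1 - γ := by linarith
  induction n with
  | zero =>
    intro b c _ _ s
    simp only [ControlledMDP.optValueN, zero_add]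
    exact div_nonneg (Finset.sum_nonneg fun _ _ => abs_nonneg _) h1.le
  | succ n ih =>
    intro b c hb hc s
    rw [ControlledMDP.optValueN]
    refine ciSup_le fun a => ?_
    refine le_trans ?_ (add_le_add_left (M.bayesMDP.le_optValueN_succ γ n (c, s) a) _)
    simp only [bayesMDP]
    have hsum : ∑ s', M.meanT b s a s' * M.bayesMDP.optValueN γ n (M.update b s a s', s') ≤
        ∑ s', M.meanT c s a s' * M.bayesMDP.optValueN γ n (M.update c s a s', s') +
          (∑ θ, |b θ - c θ|) / (1 - γ) := by
      rw [← M.sum_T_mul (fun θ => |b θ - c θ|) s a, Finset.sum_div, ← Finset.sum_add_distrib]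
      refine Finset.sum_le_sum fun s' _ => ?_
      rw [meanT_mul_bayes_optValueN M γ n hb, meanT_mul_bayes_optValueN M γ n hc]
      refine (ih (fun θ => mul_nonneg (M.T_nonneg θ s a s') (hb θ))
        (fun θ => mul_nonneg (M.T_nonneg θ s a s') (hc θ)) s').trans (le_of_eq ?_)
      congr 2
      refine Finset.sum_congr rfl fun θ _ => ?_
      rw [← mul_sub, abs_mul, abs_of_nonneg (M.T_nonneg θ s a s')]
    have h2 := M.meanR_sub_le hR b c s a
    have h3 := mul_le_mul_of_nonneg_left hsum hγ0
    have h4 : (∑ θ, |b θ - c θ|) + γ * ((∑ θ, |b θ - c θ|) / (1 - γ)) =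
        (∑ θ, |b θ - c θ|) / (1 - γ) := by field_simp; ring
    simp only [bayesMDP] at h3
    linarith

theorem bayes_optValueN_mem_Icc [Finite A] [Nonempty A] (M : MDPFamily Θ S A)
    (hR : ∀ θ s a, M.R θ s a ∈ Set.Icc (0 : ℝ) 1) {γ : ℝ} (hγ0 : 0 ≤ γ) (hγ1 : γ < 1) (n : ℕ)
    {b : Θ → ℝ} (hb : b ∈ subbeliefs Θ) (s : S) :
    M.bayesMDP.optValueN γ n (b, s) ∈ Set.Icc 0 (1 / (1 - γ)) :=
  M.bayesMDP.optValueN_mem_Icc hγ0 hγ1 {x | x.1 ∈ subbeliefs Θ} zero_le_one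
    (fun _ hx a => M.meanR_mem_Icc hR hx _ a) (fun _ hx a s => M.meanT_nonneg hx.1 _ a s)
    (fun x hx a => (M.sum_meanT x.1 x.2 a).le.trans hx.2)
    (fun _ hx a s => M.update_mem_subbeliefs hx.1 _ a s) n (b, s) hb

/-! ### The internal reward MDP -/

theorem bonus_nonneg (M : MDPFamily Θ S A) {β : ℝ} (hβ : 0 ≤ β) {b : Θ → ℝ}
    (hb : ∀ θ, 0 ≤ b θ) (s : S) (a : A) : 0 ≤ M.bonus β b s a :=
  mul_nonneg hβ (Finset.sum_nonneg fun s' _ => mul_nonneg (M.meanT_nonneg hb s a s')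
    (Finset.sum_nonneg fun _ _ => abs_nonneg _))

theorem internalR_mem_Icc (M : MDPFamily Θ S A) (hR : ∀ θ s a, M.R θ s a ∈ Set.Icc (0 : ℝ) 1)
    {γ β : ℝ} (hγ0 : 0 ≤ γ) (hγ1 : γ < 1) (hβ : 0 ≤ β) {b : Θ → ℝ} (hb : b ∈ subbeliefs Θ)
    (s : S) (a : A) : M.internalR γ β b s a ∈ Set.Icc 0 (2 / (1 - γ)) := by
  have h1 : 0 < 1 - γ := by linarith
  have h2 : 1 ≤ 1 / (1 - γ) := by rw [le_div_iff₀ h1]; linarith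
  have h3 : 2 / (1 - γ) = 1 / (1 - γ) + 1 / (1 - γ) := by ring
  have hr := M.meanR_mem_Icc hR hb s a
  refine ⟨add_nonneg hr.1 (le_min (M.bonus_nonneg hβ hb.1 s a) (by positivity)), ?_⟩
  rw [internalR, h3]
  exact add_le_add (hr.2.trans h2) (min_le_right _ _)

theorem internal_optValueN_mem_Icc [Finite A] [Nonempty A] (M : MDPFamily Θ S A)
    (hR : ∀ θ s a, M.R θ s a ∈ Set.Icc (0 : ℝ) 1) {γ β : ℝ} (hγ0 : 0 ≤ γ) (hγ1 : γ < 1)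
    (hβ : 0 ≤ β) {b : Θ → ℝ} (hb : b ∈ subbeliefs Θ) (n : ℕ) (s : S) :
    (M.internalMDP γ β b).optValueN γ n s ∈ Set.Icc 0 (2 / (1 - γ) ^ 2) := by
  have h1 : 0 < 1 - γ := by linarith
  have := (M.internalMDP γ β b).optValueN_mem_Icc hγ0 hγ1 Set.univ
    (show 0 ≤ 2 / (1 - γ) by positivity)
    (fun s _ a => M.internalR_mem_Icc hR hγ0 hγ1 hβ hb s a) (fun s _ a => M.meanT_nonneg hb.1 s a)
    (fun s _ a => (M.sum_meanT b s a).le.trans hb.2) (fun _ _ _ _ => trivial) n s trivial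
  rwa [div_div, ← sq] at this

theorem internal_optValueN_le_optValue [Finite A] [Nonempty A] (M : MDPFamily Θ S A)
    (hR : ∀ θ s a, M.R θ s a ∈ Set.Icc (0 : ℝ) 1) {γ β : ℝ} (hγ0 : 0 ≤ γ) (hγ1 : γ < 1)
    (hβ : 0 ≤ β) {b : Θ → ℝ} (hb : b ∈ subbeliefs Θ) (n : ℕ) (s : S) :
    (M.internalMDP γ β b).optValueN γ n s ≤ (M.internalMDP γ β b).optValue γ s := by
  refine le_ciSup (f := fun n => (M.internalMDP γ β b).optValueN γ n s) ⟨2 / (1 - γ) ^ 2, ?_⟩ n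
  rintro _ ⟨n, rfl⟩
  exact (M.internal_optValueN_mem_Icc hR hγ0 hγ1 hβ hb n s).2

theorem internal_optValue_mem_Icc [Finite A] [Nonempty A] (M : MDPFamily Θ S A)
    (hR : ∀ θ s a, M.R θ s a ∈ Set.Icc (0 : ℝ) 1) {γ β : ℝ} (hγ0 : 0 ≤ γ) (hγ1 : γ < 1)
    (hβ : 0 ≤ β) {b : Θ → ℝ} (hb : b ∈ subbeliefs Θ) (s : S) :
    (M.internalMDP γ β b).optValue γ s ∈ Set.Icc 0 (2 / (1 - γ) ^ 2) :=
  ⟨Real.iSup_nonneg fun n => (M.internal_optValueN_mem_Icc hR hγ0 hγ1 hβ hb n s).1,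
    ciSup_le fun n => (M.internal_optValueN_mem_Icc hR hγ0 hγ1 hβ hb n s).2⟩

/-- Only this half of Bellman's equation is needed. It follows iterate by iterate from the
definition of the value as a supremum, without a fixed-point argument. -/
theorem internal_optValue_le_internalQ [Finite A] [Nonempty A] (M : MDPFamily Θ S A)
    (hR : ∀ θ s a, M.R θ s a ∈ Set.Icc (0 : ℝ) 1) {γ β : ℝ} (hγ0 : 0 ≤ γ) (hγ1 : γ < 1)
    (hβ : 0 ≤ β) {act : (Θ → ℝ) → S → A} (hact : M.IsGreedy γ β act) {b : Θ → ℝ}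
    (hb : b ∈ stdSimplex ℝ Θ) (s : S) :
    (M.internalMDP γ β b).optValue γ s ≤ M.internalQ γ β b s (act b s) := by
  have hb' := stdSimplex_subset_subbeliefs hb
  refine ciSup_le fun n => ?_
  cases n with
  | zero =>
    exact add_nonneg (M.internalR_mem_Icc hR hγ0 hγ1 hβ hb' s _).1 (mul_nonneg hγ0
      (Finset.sum_nonneg fun s' _ => mul_nonneg (M.meanT_nonneg hb.1 s _ s')
        (M.internal_optValue_mem_Icc hR hγ0 hγ1 hβ hb' s').1))
  | succ n =>
    rw [ControlledMDP.optValueN]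
    refine ciSup_le fun a => le_trans ?_ (hact b hb s a)
    refine add_le_add le_rfl (mul_le_mul_of_nonneg_left (Finset.sum_le_sum fun s' _ => ?_) hγ0)
    exact mul_le_mul_of_nonneg_left
      (M.internal_optValueN_le_optValue hR hγ0 hγ1 hβ hb' n s') (M.meanT_nonneg hb.1 s a s')

/-- Optimism: the internal reward MDP overestimates the optimal Bayesian value. -/
theorem bayes_optValueN_le_internal [Finite A] [Nonempty A] (M : MDPFamily Θ S A)
    (hR : ∀ θ s a, M.R θ s a ∈ Set.Icc (0 : ℝ) 1) {γ β : ℝ} (hγ0 : 0 ≤ γ) (hγ1 : γ < 1)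
    (hβ : 1 / (1 - γ) ≤ β) {b : Θ → ℝ} (hb : b ∈ subbeliefs Θ) (n : ℕ) :
    ∀ s, M.bayesMDP.optValueN γ n (b, s) ≤ (M.internalMDP γ β b).optValueN γ n s := by
  have h1 : 0 < 1 - γ := by linarith
  induction n with
  | zero => exact fun s => le_rfl
  | succ n ih =>
    intro s
    rw [ControlledMDP.optValueN]
    refine ciSup_le fun a =>
      le_trans ?_ ((M.internalMDP γ β b).le_optValueN_succ γ n s a)
    have hT : ∀ s', 0 ≤ M.meanT b s a s' := M.meanT_nonneg hb.1 s a
    set W : S → ℝ := fun s' => M.bayesMDP.optValueN γ n (M.update b s a s', s') with hW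
    set V : S → ℝ := fun s' => M.bayesMDP.optValueN γ n (b, s') with hV
    -- The bound by the bonus is the Lipschitz estimate; the bound by `1 / (1 - γ)` is the range of
    -- the values. This is why truncating the bonus keeps optimism.
    have hWV : ∑ s', M.meanT b s a s' * W s' - ∑ s', M.meanT b s a s' * V s' ≤
        min (M.bonus β b s a) (1 / (1 - γ)) := by
      rw [← Finset.sum_sub_distrib]
      refine le_min ?_ ?_
      · calc _ ≤ ∑ s', M.meanT b s a s' *
                (β * ∑ θ, |M.update b s a s' θ - b θ|) := by
              refine Finset.sum_le_sum fun s' _ => ?_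
              rw [← mul_sub]
              refine mul_le_mul_of_nonneg_left ?_ (hT s')
              have h2 := M.bayes_optValueN_sub_le hR hγ0 hγ1 n
                (M.update_mem_subbeliefs hb.1 s a s').1 hb.1 s'
              have h3 : 0 ≤ ∑ θ, |M.update b s a s' θ - b θ| :=
                Finset.sum_nonneg fun _ _ => abs_nonneg _
              have h4 := mul_le_mul_of_nonneg_right hβ h3
              rw [one_div_mul_eq_div] at h4
              simp only [hW, hV]
              linarith
          _ = _ := by
              rw [bonus, Finset.mul_sum]
              exact Finset.sum_congr rfl fun s' _ => by ring
      · simp only [← mul_sub]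
        refine M.sum_meanT_mul_le hb s a (by positivity) fun s' => ?_
        have h2 := (M.bayes_optValueN_mem_Icc hR hγ0 hγ1 n
          (M.update_mem_subbeliefs hb.1 s a s') s').2
        have h3 := (M.bayes_optValueN_mem_Icc hR hγ0 hγ1 n hb s').1
        simp only [hW, hV]
        linarith
    -- The bonus is paid undiscounted but only `γ` times it is needed; nonnegativity covers the
    -- difference.
    have hmin : 0 ≤ min (M.bonus β b s a) (1 / (1 - γ)) :=
      le_min (M.bonus_nonneg (le_trans (by positivity) hβ) hb.1 s a) (by positivity)
    have hle : ∑ s', M.meanT b s a s' * V s' ≤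
        ∑ s', M.meanT b s a s' * (M.internalMDP γ β b).optValueN γ n s' :=
      Finset.sum_le_sum fun s' _ => mul_le_mul_of_nonneg_left (ih s') (hT s')
    change M.meanR b s a + γ * ∑ s', M.meanT b s a s' * W s' ≤
      M.internalR γ β b s a +
        γ * ∑ s', M.meanT b s a s' * (M.internalMDP γ β b).optValueN γ n s'
    rw [internalR]
    nlinarith [mul_le_mul_of_nonneg_left hWV hγ0, mul_le_mul_of_nonneg_left hle hγ0]

theorem bayesOptValue_le_internal [Finite A] [Nonempty A] (M : MDPFamily Θ S A)
    (hR : ∀ θ s a, M.R θ s a ∈ Set.Icc (0 : ℝ) 1) {γ β : ℝ} (hγ0 : 0 ≤ γ) (hγ1 : γ < 1)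
    (hβ : 1 / (1 - γ) ≤ β) {b : Θ → ℝ} (hb : b ∈ subbeliefs Θ) (s : S) :
    M.bayesOptValue γ b s ≤ (M.internalMDP γ β b).optValue γ s :=
  ciSup_le fun n => (M.bayes_optValueN_le_internal hR hγ0 hγ1 hβ hb n s).trans
    (M.internal_optValueN_le_optValue hR hγ0 hγ1
      (le_trans (one_div_nonneg.2 (sub_nonneg.2 hγ1.le)) hβ) hb n s)

variable [DecidableEq S] [DecidableEq A]

/-! ### The known part of the value and the discounted escape probability -/

/-- The action chosen at `g` by the algorithm is known, so that no belief update is made. -/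
def Settled (ζ : S → A → ℕ) (act : (Θ → ℝ) → S → A) (g : Agent Θ S A) : Prop :=
  ζ g.state (act g.belief g.state) < g.visits g.state (act g.belief g.state)

/-- Expected discounted mean reward collected within `n` steps and before the first visit to a pair
that is not known, the transitions being governed by the algorithm's belief. -/
noncomputable def knownValueN (M : MDPFamily Θ S A) (γ : ℝ) (ζ : S → A → ℕ)
    (act : (Θ → ℝ) → S → A) : ℕ → Agent Θ S A → ℝ
  | 0, _ => 0
  | n + 1, g =>
    open Classical in
    if Settled ζ act g then
      M.meanR g.belief g.state (act g.belief g.state) +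
        γ * ∑ s', M.meanT g.belief g.state (act g.belief g.state) s' *
          M.knownValueN γ ζ act n (M.agentStep ζ g (act g.belief g.state) s')
    else 0

/-- The expectation of `γ ^ τ` over `τ < n`, where `τ` is the time of the first visit to a pair
that is not known, the transitions being governed by the algorithm's belief. -/
noncomputable def escapeN (M : MDPFamily Θ S A) (γ : ℝ) (ζ : S → A → ℕ)
    (act : (Θ → ℝ) → S → A) : ℕ → Agent Θ S A → ℝ
  | 0, _ => 0
  | n + 1, g =>
    open Classical in
    if Settled ζ act g then
      γ * ∑ s', M.meanT g.belief g.state (act g.belief g.state) s' *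
        M.escapeN γ ζ act n (M.agentStep ζ g (act g.belief g.state) s')
    else 1

/-- The expectation of `γ ^ τ`, where `τ` is the time of the first visit to a pair that is not
known. -/
noncomputable def escape (M : MDPFamily Θ S A) (γ : ℝ) (ζ : S → A → ℕ)
    (act : (Θ → ℝ) → S → A) (g : Agent Θ S A) : ℝ := ⨆ n, M.escapeN γ ζ act n g

/-- The number of visits still to be made to pairs before they are known. -/
def pendingVisits [Fintype A] (ζ : S → A → ℕ) (g : Agent Θ S A) : ℕ :=
  ∑ s, ∑ a, (ζ s a + 1 - g.visits s a)

theorem agentStep_belief_of_settled (M : MDPFamily Θ S A) {ζ : S → A → ℕ}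
    {act : (Θ → ℝ) → S → A} {g : Agent Θ S A} (h : Settled ζ act g) (s' : S) :
    (M.agentStep ζ g (act g.belief g.state) s').belief = g.belief := if_pos h

theorem agentStep_belief_mem_subbeliefs (M : MDPFamily Θ S A) (ζ : S → A → ℕ)
    {g : Agent Θ S A} (hg : g.belief ∈ subbeliefs Θ) (a : A) (s' : S) :
    (M.agentStep ζ g a s').belief ∈ subbeliefs Θ := by
  simp only [agentStep]
  split_ifs
  · exact hg
  · exact M.update_mem_subbeliefs hg.1 _ _ _

theorem knownValueN_mem_Icc (M : MDPFamily Θ S A)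
    (hR : ∀ θ s a, M.R θ s a ∈ Set.Icc (0 : ℝ) 1) {γ : ℝ} (hγ0 : 0 ≤ γ) (hγ1 : γ < 1)
    (ζ : S → A → ℕ) (act : (Θ → ℝ) → S → A) (n : ℕ) :
    ∀ g : Agent Θ S A, g.belief ∈ subbeliefs Θ →
      M.knownValueN γ ζ act n g ∈ Set.Icc 0 (1 / (1 - γ)) := by
  have h1 : 0 < 1 - γ := by linarith
  have h2 : (0 : ℝ) ≤ 1 / (1 - γ) := by positivity
  induction n with
  | zero => exact fun g _ => ⟨le_rfl, h2⟩
  | succ n ih =>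
    intro g hg
    rw [knownValueN]
    split_ifs with h
    · have hr := M.meanR_mem_Icc hR hg g.state (act g.belief g.state)
      have ih' := fun s' => ih _ (M.agentStep_belief_mem_subbeliefs ζ hg (act g.belief g.state) s')
      have hl := M.sum_meanT_mul_nonneg hg g.state (act g.belief g.state) fun s' => (ih' s').1
      have hu := M.sum_meanT_mul_le hg g.state (act g.belief g.state) h2 fun s' => (ih' s').2
      refine ⟨add_nonneg hr.1 (mul_nonneg hγ0 hl), ?_⟩
      have h3 : 1 + γ * (1 / (1 - γ)) = 1 / (1 - γ) := by field_simp; ring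
      have := mul_le_mul_of_nonneg_left hu hγ0
      linarith [hr.2]
    · exact ⟨le_rfl, h2⟩

theorem escapeN_mem_Icc (M : MDPFamily Θ S A) {γ : ℝ} (hγ0 : 0 ≤ γ) (hγ1 : γ < 1)
    (ζ : S → A → ℕ) (act : (Θ → ℝ) → S → A) (n : ℕ) :
    ∀ g : Agent Θ S A, g.belief ∈ subbeliefs Θ →
      M.escapeN γ ζ act n g ∈ Set.Icc (0 : ℝ) 1 := by
  induction n with
  | zero => exact fun g _ => ⟨le_rfl, zero_le_one⟩
  | succ n ih =>
    intro g hg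
    rw [escapeN]
    split_ifs with h
    · have ih' := fun s' => ih _ (M.agentStep_belief_mem_subbeliefs ζ hg (act g.belief g.state) s')
      have hl := M.sum_meanT_mul_nonneg hg g.state (act g.belief g.state) fun s' => (ih' s').1
      have hu := M.sum_meanT_mul_le hg g.state (act g.belief g.state) zero_le_one
        fun s' => (ih' s').2
      exact ⟨mul_nonneg hγ0 hl, mul_le_one₀ hγ1.le hl hu⟩
    · exact ⟨zero_le_one, le_rfl⟩

theorem escapeN_le_escape (M : MDPFamily Θ S A) {γ : ℝ} (hγ0 : 0 ≤ γ) (hγ1 : γ < 1)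
    (ζ : S → A → ℕ) (act : (Θ → ℝ) → S → A) (n : ℕ) {g : Agent Θ S A}
    (hg : g.belief ∈ subbeliefs Θ) : M.escapeN γ ζ act n g ≤ M.escape γ ζ act g := by
  refine le_ciSup (f := fun n => M.escapeN γ ζ act n g) ⟨1, ?_⟩ n
  rintro _ ⟨n, rfl⟩
  exact (M.escapeN_mem_Icc hγ0 hγ1 ζ act n g hg).2

theorem escape_mem_Icc (M : MDPFamily Θ S A) {γ : ℝ} (hγ0 : 0 ≤ γ) (hγ1 : γ < 1)
    (ζ : S → A → ℕ) (act : (Θ → ℝ) → S → A) {g : Agent Θ S A} (hg : g.belief ∈ subbeliefs Θ) :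
    M.escape γ ζ act g ∈ Set.Icc (0 : ℝ) 1 :=
  ⟨Real.iSup_nonneg fun n => (M.escapeN_mem_Icc hγ0 hγ1 ζ act n g hg).1,
    ciSup_le fun n => (M.escapeN_mem_Icc hγ0 hγ1 ζ act n g hg).2⟩

theorem escape_le_of_settled (M : MDPFamily Θ S A) {γ : ℝ} (hγ0 : 0 ≤ γ) (hγ1 : γ < 1)
    (ζ : S → A → ℕ) (act : (Θ → ℝ) → S → A) {g : Agent Θ S A} (hg : g.belief ∈ subbeliefs Θ)
    (h : Settled ζ act g) :
    M.escape γ ζ act g ≤ γ * ∑ s', M.meanT g.belief g.state (act g.belief g.state) s' *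
      M.escape γ ζ act (M.agentStep ζ g (act g.belief g.state) s') := by
  have hstep := fun s' => M.agentStep_belief_mem_subbeliefs ζ hg (act g.belief g.state) s'
  refine ciSup_le fun n => ?_
  cases n with
  | zero =>
    exact mul_nonneg hγ0 (M.sum_meanT_mul_nonneg hg _ _ fun s' =>
      (M.escape_mem_Icc hγ0 hγ1 ζ act (hstep s')).1)
  | succ n =>
    rw [escapeN, if_pos h]
    exact mul_le_mul_of_nonneg_left (Finset.sum_le_sum fun s' _ => mul_le_mul_of_nonneg_left
      (M.escapeN_le_escape hγ0 hγ1 ζ act n (hstep s')) (M.meanT_nonneg hg.1 _ _ s')) hγ0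

theorem pendingVisits_agentStep_of_settled [Fintype A] (M : MDPFamily Θ S A) {ζ : S → A → ℕ}
    {act : (Θ → ℝ) → S → A} {g : Agent Θ S A} (h : Settled ζ act g) (s' : S) :
    pendingVisits ζ (M.agentStep ζ g (act g.belief g.state) s') = pendingVisits ζ g := by
  refine Finset.sum_congr rfl fun s _ => Finset.sum_congr rfl fun a _ => ?_
  simp only [agentStep, countVisit]
  split_ifs with hs
  -- For a known pair the truncated difference is zero both before and after the visit.
  · obtain ⟨rfl, rfl⟩ := hs
    unfold Settled at h
    omega
  · rfl

theorem pendingVisits_agentStep_of_not_settled [Fintype A] (M : MDPFamily Θ S A)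
    {ζ : S → A → ℕ} {act : (Θ → ℝ) → S → A} {g : Agent Θ S A} (h : ¬ Settled ζ act g) (s' : S) :
    pendingVisits ζ (M.agentStep ζ g (act g.belief g.state) s') + 1 = pendingVisits ζ g := by
  have key : ∀ s a, ζ s a + 1 - (M.agentStep ζ g (act g.belief g.state) s').visits s a +
      (if s = g.state then if a = act g.belief g.state then 1 else 0 else 0) =
      ζ s a + 1 - g.visits s a := by
    intro s a
    simp only [agentStep, countVisit, ← ite_and]
    split_ifs with hs
    · obtain ⟨rfl, rfl⟩ := hs
      unfold Settled at h
      omega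
    · rfl
  unfold pendingVisits
  simp_rw [← key, Finset.sum_add_distrib]
  congr 1
  simp [Finset.sum_ite_eq']

/-- Settled steps leave the number of pending visits unchanged, and an unsettled state has at least
one pending visit. So with none pending no escape can ever occur, and otherwise the bound by one
suffices. -/
theorem escape_le_pendingVisits [Fintype A] (M : MDPFamily Θ S A) {γ : ℝ} (hγ0 : 0 ≤ γ)
    (hγ1 : γ < 1) (ζ : S → A → ℕ) (act : (Θ → ℝ) → S → A) {g : Agent Θ S A}
    (hg : g.belief ∈ subbeliefs Θ) : M.escape γ ζ act g ≤ pendingVisits ζ g := by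
  refine ciSup_le fun n => ?_
  induction n generalizing g with
  | zero => exact Nat.cast_nonneg _
  | succ n ih =>
    rw [escapeN]
    split_ifs with h
    · have hstep := fun s' => M.agentStep_belief_mem_subbeliefs ζ hg (act g.belief g.state) s'
      refine (mul_le_of_le_one_left (M.sum_meanT_mul_nonneg hg _ _ fun s' =>
        (M.escapeN_mem_Icc hγ0 hγ1 ζ act n _ (hstep s')).1) hγ1.le).trans ?_
      refine M.sum_meanT_mul_le hg _ _ (Nat.cast_nonneg _) fun s' => (ih (hstep s')).trans ?_
      rw [M.pendingVisits_agentStep_of_settled h]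
    · have := M.pendingVisits_agentStep_of_not_settled h g.state
      exact_mod_cast (by omega : 1 ≤ pendingVisits ζ g)

/-! ### Beliefs reached by sampling -/

theorem Sampled.mem_stdSimplex {M : MDPFamily Θ S A} {b₀ : Θ → ℝ} (hb₀ : b₀ ∈ stdSimplex ℝ Θ)
    {n : S → A → ℕ} {b : Θ → ℝ} (h : M.Sampled b₀ n b) : b ∈ stdSimplex ℝ Θ := by
  induction h with
  | start => exact hb₀
  | sample _ s a s' hpos ih => exact M.update_mem_stdSimplex ih.1 hpos

/-- The belief `b` results from sampled transitions that include, for each pair, the first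
`ζ s a + 1` of the visits counted by `v`. -/
def Supported (M : MDPFamily Θ S A) (b₀ : Θ → ℝ) (ζ v : S → A → ℕ) (b : Θ → ℝ) : Prop :=
  ∃ n, M.Sampled b₀ n b ∧ ∀ s a, min (v s a) (ζ s a + 1) ≤ n s a

theorem Supported.mem_stdSimplex {M : MDPFamily Θ S A} {b₀ : Θ → ℝ}
    (hb₀ : b₀ ∈ stdSimplex ℝ Θ) {ζ v : S → A → ℕ} {b : Θ → ℝ} (h : M.Supported b₀ ζ v b) :
    b ∈ stdSimplex ℝ Θ :=
  h.elim fun _ h => h.1.mem_stdSimplex hb₀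

theorem Supported.update {M : MDPFamily Θ S A} {b₀ : Θ → ℝ} {ζ v : S → A → ℕ} {b : Θ → ℝ}
    (h : M.Supported b₀ ζ v b) {s : S} {a : A} {s' : S} (hpos : 0 < M.meanT b s a s') :
    M.Supported b₀ ζ (countVisit v s a) (M.update b s a s') := by
  obtain ⟨n, hn, hv⟩ := h
  refine ⟨_, hn.sample s a s' hpos, fun s₁ a₁ => ?_⟩
  have := hv s₁ a₁
  simp only [countVisit]
  split_ifs <;> omega

/-- A visit to a known pair is counted without being sampled; the cap at `ζ s a + 1` makes this
harmless. -/
theorem Supported.countVisit_of_lt {M : MDPFamily Θ S A} {b₀ : Θ → ℝ} {ζ v : S → A → ℕ}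
    {b : Θ → ℝ} (h : M.Supported b₀ ζ v b) {s : S} {a : A} (hlt : ζ s a < v s a) :
    M.Supported b₀ ζ (countVisit v s a) b := by
  obtain ⟨n, hn, hv⟩ := h
  refine ⟨n, hn, fun s₁ a₁ => ?_⟩
  have := hv s₁ a₁
  simp only [countVisit]
  split_ifs with hs
  · obtain ⟨rfl, rfl⟩ := hs
    omega
  · exact this

theorem Supported.agentStep {M : MDPFamily Θ S A} {b₀ : Θ → ℝ} {ζ : S → A → ℕ}
    {g : Agent Θ S A} (h : M.Supported b₀ ζ g.visits g.belief) {a : A} {s' : S}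
    (hpos : 0 < M.meanT g.belief g.state a s') :
    M.Supported b₀ ζ (M.agentStep ζ g a s').visits (M.agentStep ζ g a s').belief := by
  simp only [MDPFamily.agentStep]
  split_ifs with hlt
  · exact h.countVisit_of_lt hlt
  · exact h.update hpos

theorem Supported.bonus_lt {M : MDPFamily Θ S A} {b₀ : Θ → ℝ} {ζ v : S → A → ℕ} {b : Θ → ℝ}
    {β κ : ℝ} (h : M.Supported b₀ ζ v b) (hζ : M.IsSampleComplexity β κ b₀ ζ) {s : S} {a : A}
    (hlt : ζ s a < v s a) : M.bonus β b s a < κ := by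
  obtain ⟨n, hn, hv⟩ := h
  exact hζ n b hn s a (by have := hv s a; omega)

/-! ### Comparison of the algorithm's value with the optimal value -/

/-- While states are settled the belief is frozen, so the algorithm acts greedily in a single
internal MDP and each step costs a bonus of at most `κ`. On escape, or at the horizon, the crude
bound `2 / (1 - γ) ^ 2` on the internal value is charged to `escapeN` or to `γ ^ n`. -/
theorem internal_optValue_le_knownValueN [Finite A] [Nonempty A] (M : MDPFamily Θ S A)
    (hR : ∀ θ s a, M.R θ s a ∈ Set.Icc (0 : ℝ) 1) {γ β κ : ℝ} (hγ0 : 0 ≤ γ) (hγ1 : γ < 1)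
    (hβ : 0 ≤ β) (hκ : 0 ≤ κ) {b₀ : Θ → ℝ} (hb₀ : b₀ ∈ stdSimplex ℝ Θ) {ζ : S → A → ℕ}
    (hζ : M.IsSampleComplexity β κ b₀ ζ) {act : (Θ → ℝ) → S → A} (hact : M.IsGreedy γ β act)
    (n : ℕ) : ∀ g : Agent Θ S A, M.Supported b₀ ζ g.visits g.belief →
      (M.internalMDP γ β g.belief).optValue γ g.state ≤
        M.knownValueN γ ζ act n g + κ / (1 - γ) +
          2 / (1 - γ) ^ 2 * (M.escapeN γ ζ act n g + γ ^ n) := by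
  have h1 : 0 < 1 - γ := by linarith
  have h2 : 0 ≤ 2 / (1 - γ) ^ 2 := by positivity
  induction n with
  | zero =>
    intro g hg
    have := (M.internal_optValue_mem_Icc hR hγ0 hγ1 hβ
      (stdSimplex_subset_subbeliefs (hg.mem_stdSimplex hb₀)) g.state).2
    have h3 : 0 ≤ κ / (1 - γ) := by positivity
    simp only [knownValueN, escapeN, pow_zero]
    linarith
  | succ n ih =>
    intro g hg
    have hb := hg.mem_stdSimplex hb₀
    have hb' := stdSimplex_subset_subbeliefs hb
    rw [knownValueN, escapeN]
    split_ifs with h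
    · refine (M.internal_optValue_le_internalQ hR hγ0 hγ1 hβ hact hb g.state).trans ?_
      set a := act g.belief g.state with ha
      have hlt : M.internalR γ β g.belief g.state a ≤ M.meanR g.belief g.state a + κ :=
        add_le_add le_rfl ((min_le_left _ _).trans (hg.bonus_lt hζ h).le)
      have hsum : ∑ s', M.meanT g.belief g.state a s' *
          (M.internalMDP γ β g.belief).optValue γ s' ≤
          ∑ s', M.meanT g.belief g.state a s' *
            M.knownValueN γ ζ act n (M.agentStep ζ g a s') + κ / (1 - γ) +
          2 / (1 - γ) ^ 2 * (∑ s', M.meanT g.belief g.state a s' *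
            M.escapeN γ ζ act n (M.agentStep ζ g a s') + γ ^ n) := by
        have hT : ∑ s', M.meanT g.belief g.state a s' = 1 := (M.sum_meanT _ _ _).trans hb.2
        calc _ ≤ ∑ s', M.meanT g.belief g.state a s' *
              (M.knownValueN γ ζ act n (M.agentStep ζ g a s') + κ / (1 - γ) +
                2 / (1 - γ) ^ 2 * (M.escapeN γ ζ act n (M.agentStep ζ g a s') + γ ^ n)) := by
              refine Finset.sum_le_sum fun s' _ => ?_
              -- `Supported` passes only to outcomes of positive probability; the others carry zero
              -- weight.
              rcases (M.meanT_nonneg hb.1 g.state a s').eq_or_lt with h0 | h0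
              · simp [← h0]
              · refine mul_le_mul_of_nonneg_left ?_ h0.le
                have := ih _ (hg.agentStep h0)
                rwa [M.agentStep_belief_of_settled h] at this
          _ = ∑ s', M.meanT g.belief g.state a s' *
                M.knownValueN γ ζ act n (M.agentStep ζ g a s') +
              (∑ s', M.meanT g.belief g.state a s') * (κ / (1 - γ)) +
              2 / (1 - γ) ^ 2 * (∑ s', M.meanT g.belief g.state a s' *
                M.escapeN γ ζ act n (M.agentStep ζ g a s') +
                (∑ s', M.meanT g.belief g.state a s') * γ ^ n) := by
              simp only [mul_add, Finset.sum_add_distrib, Finset.sum_mul, Finset.mul_sum]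
              congr 1
              congr 1 <;> exact Finset.sum_congr rfl fun _ _ => by ring
          _ = _ := by rw [hT, one_mul, one_mul]
      have h3 : κ + γ * (κ / (1 - γ)) = κ / (1 - γ) := by field_simp; ring
      have h4 := mul_le_mul_of_nonneg_left hsum hγ0
      rw [internalQ, pow_succ γ n]
      simp only [mul_add] at h4 ⊢
      linarith
    · have := (M.internal_optValue_mem_Icc hR hγ0 hγ1 hβ hb' g.state).2
      have h3 : 0 ≤ κ / (1 - γ) := by positivity
      have h4 : 0 ≤ 2 / (1 - γ) ^ 2 * γ ^ (n + 1) := by positivity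
      simp only [mul_add]
      linarith

theorem eval_policyValueN_mem_Icc (M : MDPFamily Θ S A)
    (hR : ∀ θ s a, M.R θ s a ∈ Set.Icc (0 : ℝ) 1) {γ : ℝ} (hγ0 : 0 ≤ γ) (hγ1 : γ < 1)
    (ζ : S → A → ℕ) (π : (Θ → ℝ) × Agent Θ S A → A) (n : ℕ) {x : (Θ → ℝ) × Agent Θ S A}
    (hx : x.1 ∈ subbeliefs Θ) :
    (M.evalMDP ζ).policyValueN γ π n x ∈ Set.Icc 0 (1 / (1 - γ)) :=
  (M.evalMDP ζ).policyValueN_mem_Icc hγ0 hγ1 {x | x.1 ∈ subbeliefs Θ} zero_le_one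
    (fun _ hx a => M.meanR_mem_Icc hR hx _ a) (fun _ hx a s => M.meanT_nonneg hx.1 _ a s)
    (fun x hx a => (M.sum_meanT x.1 x.2.state a).le.trans hx.2)
    (fun _ hx a s => M.update_mem_subbeliefs hx.1 _ a s) π n x hx

/-- The frozen belief of `g` and the moving Bayesian belief `c` separate, so the induction needs an
arbitrary `c` and a term for their distance. As `c` has absorbed enough samples of every known pair,
its bonuses there are small, which limits its expected movement. -/
theorem knownValueN_le_eval_policyValueN (M : MDPFamily Θ S A)
    (hR : ∀ θ s a, M.R θ s a ∈ Set.Icc (0 : ℝ) 1) {γ β ε : ℝ} (hγ0 : 0 ≤ γ) (hγ1 : γ < 1)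
    (hβ : 1 / (1 - γ) ^ 2 ≤ β) (hε : 0 ≤ ε) {b₀ : Θ → ℝ} (hb₀ : b₀ ∈ stdSimplex ℝ Θ)
    {ζ : S → A → ℕ} (hζ : M.IsSampleComplexity β (ε * (1 - γ)) b₀ ζ) (act : (Θ → ℝ) → S → A)
    (n : ℕ) : ∀ (c : Θ → ℝ) (g : Agent Θ S A), g.belief ∈ subbeliefs Θ →
      M.Supported b₀ ζ g.visits c →
      M.knownValueN γ ζ act n g ≤
        (M.evalMDP ζ).policyValueN γ (fun x => act x.2.belief x.2.state) n (c, g) +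
          (∑ θ, |g.belief θ - c θ|) / (1 - γ) ^ 2 + ε := by
  have h1 : 0 < 1 - γ := by linarith
  have hd : ∀ b c : Θ → ℝ, 0 ≤ ∑ θ, |b θ - c θ| := fun b c =>
    Finset.sum_nonneg fun _ _ => abs_nonneg _
  induction n with
  | zero =>
    intro c g _ _
    simp only [knownValueN, ControlledMDP.policyValueN, zero_add]
    exact add_nonneg (div_nonneg (hd _ _) (by positivity)) hε
  | succ n ih =>
    intro c g hg hc
    have hcs := hc.mem_stdSimplex hb₀
    have hcs' := stdSimplex_subset_subbeliefs hcs
    rw [knownValueN]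
    split_ifs with h
    · rw [ControlledMDP.policyValueN]
      set a := act g.belief g.state with ha
      set d := ∑ θ, |g.belief θ - c θ| with hdd
      have hd0 : 0 ≤ d := hd _ _
      set f : S → ℝ := fun s' => M.knownValueN γ ζ act n (M.agentStep ζ g a s') with hf
      set V : S → ℝ := fun s' => (M.evalMDP ζ).policyValueN γ
        (fun x => act x.2.belief x.2.state) n (M.update c g.state a s', M.agentStep ζ g a s')
        with hV
      have hfI : ∀ s', f s' ∈ Set.Icc 0 (1 / (1 - γ)) := fun s' =>
        M.knownValueN_mem_Icc hR hγ0 hγ1 ζ act n _ (M.agentStep_belief_mem_subbeliefs ζ hg a s')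
      have hstep1 : ∑ s', M.meanT g.belief g.state a s' * f s' ≤
          ∑ s', M.meanT c g.state a s' * f s' + d / (1 - γ) := by
        have h2 : ∑ s', (M.meanT g.belief g.state a s' - M.meanT c g.state a s') * f s' ≤
            (∑ s', |M.meanT g.belief g.state a s' - M.meanT c g.state a s'|) *
              (1 / (1 - γ)) := by
          rw [Finset.sum_mul]
          refine Finset.sum_le_sum fun s' _ => ?_
          calc _ ≤ |M.meanT g.belief g.state a s' - M.meanT c g.state a s'| * f s' :=
                mul_le_mul_of_nonneg_right (le_abs_self _) (hfI s').1
            _ ≤ _ := mul_le_mul_of_nonneg_left (hfI s').2 (abs_nonneg _)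
        have h3 := mul_le_mul_of_nonneg_right (M.sum_abs_meanT_sub_le g.belief c g.state a)
          (show 0 ≤ 1 / (1 - γ) by positivity)
        rw [mul_one_div d] at h3
        simp only [sub_mul, Finset.sum_sub_distrib] at h2
        linarith
      have hT : ∑ s', M.meanT c g.state a s' = 1 := (M.sum_meanT _ _ _).trans hcs.2
      -- The induction hypothesis is applied at the posterior of `c`; the triangle inequality splits
      -- the new distance into `d` and the movement of `c`.
      have hstep2 : ∑ s', M.meanT c g.state a s' * f s' ≤
          ∑ s', M.meanT c g.state a s' * V s' + d / (1 - γ) ^ 2 +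
            (∑ s', M.meanT c g.state a s' * ∑ θ, |M.update c g.state a s' θ - c θ|) /
              (1 - γ) ^ 2 + ε := by
        calc _ ≤ ∑ s', M.meanT c g.state a s' * (V s' + (d +
                ∑ θ, |M.update c g.state a s' θ - c θ|) / (1 - γ) ^ 2 + ε) := by
              refine Finset.sum_le_sum fun s' _ => ?_
              rcases (M.meanT_nonneg hcs.1 g.state a s').eq_or_lt with h0 | h0
              · simp [← h0]
              · refine mul_le_mul_of_nonneg_left ?_ h0.le
                refine (ih (M.update c g.state a s') _
                  (M.agentStep_belief_mem_subbeliefs ζ hg a s') (hc.update h0)).trans ?_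
                rw [M.agentStep_belief_of_settled h]
                gcongr
                rw [hdd, ← Finset.sum_add_distrib]
                refine Finset.sum_le_sum fun θ _ => ?_
                rw [abs_sub_comm (M.update c g.state a s' θ)]
                exact abs_sub_le _ _ _
          _ = ∑ s', M.meanT c g.state a s' * V s' +
              (∑ s', M.meanT c g.state a s') * (d / (1 - γ) ^ 2) +
              (∑ s', M.meanT c g.state a s' * ∑ θ, |M.update c g.state a s' θ - c θ|) /
              (1 - γ) ^ 2 + (∑ s', M.meanT c g.state a s') * ε := by
              simp only [add_div, mul_add, Finset.sum_add_distrib, Finset.sum_mul, Finset.sum_div,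
                mul_div_assoc, add_assoc]
          _ = _ := by rw [hT, one_mul, one_mul]
      have hbonus : (∑ s', M.meanT c g.state a s' * ∑ θ, |M.update c g.state a s' θ - c θ|) /
          (1 - γ) ^ 2 ≤ ε * (1 - γ) := by
        refine le_trans ?_ (hc.bonus_lt hζ h).le
        rw [bonus, ← one_div_mul_eq_div]
        exact mul_le_mul_of_nonneg_right hβ
          (M.sum_meanT_mul_nonneg hcs' _ _ fun s' => hd _ _)
      have hr := M.meanR_sub_le hR g.belief c g.state a
      rw [← hdd] at hr
      -- The coefficient `x = 1 / (1 - γ) ^ 2` solves `x = 1 + γ / (1 - γ) + γ * x`, the terms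
      -- coming from rewards, transitions and the future.
      have h5 : d + γ * (d / (1 - γ)) + γ * (d / (1 - γ) ^ 2) = d / (1 - γ) ^ 2 := by
        field_simp
        ring
      have h6 := mul_le_mul_of_nonneg_left hstep1 hγ0
      have h7 := mul_le_mul_of_nonneg_left hstep2 hγ0
      have h8 := mul_le_mul_of_nonneg_left hbonus hγ0
      have h9 : γ * (ε * (1 - γ)) ≤ ε * (1 - γ) :=
        mul_le_of_le_one_left (by positivity) hγ1.le
      simp only [mul_add] at h6 h7
      change M.meanR g.belief g.state a + γ * ∑ s', M.meanT g.belief g.state a s' * f s' ≤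
        M.meanR c g.state a + γ * ∑ s', M.meanT c g.state a s' * V s' + d / (1 - γ) ^ 2 + ε
      linarith
    · have h2 := (M.eval_policyValueN_mem_Icc hR hγ0 hγ1 ζ
        (fun x => act x.2.belief x.2.state) (n + 1) (x := (c, g)) hcs').1
      have h3 : 0 ≤ (∑ θ, |g.belief θ - c θ|) / (1 - γ) ^ 2 := div_nonneg (hd _ _) (by positivity)
      linarith

theorem eval_policyValueN_le_algValue (M : MDPFamily Θ S A)
    (hR : ∀ θ s a, M.R θ s a ∈ Set.Icc (0 : ℝ) 1) {γ : ℝ} (hγ0 : 0 ≤ γ) (hγ1 : γ < 1)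
    (ζ : S → A → ℕ) (act : (Θ → ℝ) → S → A) (n : ℕ) {g : Agent Θ S A}
    (hg : g.belief ∈ subbeliefs Θ) :
    (M.evalMDP ζ).policyValueN γ (fun x => act x.2.belief x.2.state) n (g.belief, g) ≤
      M.algValue γ ζ act g := by
  refine le_ciSup (f := fun n => (M.evalMDP ζ).policyValueN γ
    (fun x => act x.2.belief x.2.state) n (g.belief, g)) ⟨1 / (1 - γ), ?_⟩ n
  rintro _ ⟨n, rfl⟩
  exact (M.eval_policyValueN_mem_Icc hR hγ0 hγ1 ζ _ n (x := (g.belief, g)) hg).2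

/-- At time `t` the two beliefs coincide, so the distance term vanishes; letting the horizon tend to
infinity removes `γ ^ n`. -/
theorem bayesOptValue_le_algValue_add_escape [Finite A] [Nonempty A] (M : MDPFamily Θ S A)
    (hR : ∀ θ s a, M.R θ s a ∈ Set.Icc (0 : ℝ) 1) {γ β ε : ℝ} (hγ0 : 0 ≤ γ) (hγ1 : γ < 1)
    (hβ : 1 / (1 - γ) ^ 2 ≤ β) (hε : 0 ≤ ε) {b₀ : Θ → ℝ} (hb₀ : b₀ ∈ stdSimplex ℝ Θ)
    {ζ : S → A → ℕ} (hζ : M.IsSampleComplexity β (ε * (1 - γ)) b₀ ζ) {act : (Θ → ℝ) → S → A}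
    (hact : M.IsGreedy γ β act) {g : Agent Θ S A} (hg : M.Supported b₀ ζ g.visits g.belief) :
    M.bayesOptValue γ g.belief g.state ≤
      M.algValue γ ζ act g + 2 * ε + 2 / (1 - γ) ^ 2 * M.escape γ ζ act g := by
  have h1 : 0 < 1 - γ := by linarith
  have hb := stdSimplex_subset_subbeliefs (hg.mem_stdSimplex hb₀)
  have hβ0 : 0 ≤ β := le_trans (by positivity) hβ
  have hβ1 : 1 / (1 - γ) ≤ β := by
    refine le_trans ?_ hβ
    gcongr
    exact pow_le_of_le_one h1.le (by linarith) two_ne_zero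
  have key : ∀ n : ℕ, M.bayesOptValue γ g.belief g.state ≤
      M.algValue γ ζ act g + 2 * ε + 2 / (1 - γ) ^ 2 * (M.escape γ ζ act g + γ ^ n) := by
    intro n
    have h2 := M.bayesOptValue_le_internal hR hγ0 hγ1 hβ1 hb g.state
    have h3 := M.internal_optValue_le_knownValueN hR hγ0 hγ1 hβ0 (by positivity) hb₀ hζ hact n g hg
    have h4 := M.knownValueN_le_eval_policyValueN hR hγ0 hγ1 hβ hε hb₀ hζ act n g.belief g hb hg
    have h5 := M.eval_policyValueN_le_algValue hR hγ0 hγ1 ζ act n hb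
    have h6 : 2 / (1 - γ) ^ 2 * (M.escapeN γ ζ act n g + γ ^ n) ≤
        2 / (1 - γ) ^ 2 * (M.escape γ ζ act g + γ ^ n) := by
      gcongr
      exact M.escapeN_le_escape hγ0 hγ1 ζ act n hb
    rw [mul_div_cancel_right₀ _ h1.ne'] at h3
    simp only [sub_self, abs_zero, Finset.sum_const_zero, zero_div, add_zero] at h4
    linarith
  have := (tendsto_pow_atTop_nhds_zero_of_lt_one hγ0 hγ1).const_add (M.escape γ ζ act g)
  rw [add_zero] at this
  exact ge_of_tendsto' ((this.const_mul _).const_add _) key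

/-! ### A potential function for the number of time steps with large escape probability -/

/-- A potential which decreases on average by at least `(1 - γ) * escape` at every step. -/
noncomputable def escapePotential [Fintype A] (M : MDPFamily Θ S A) (γ : ℝ) (ζ : S → A → ℕ)
    (act : (Θ → ℝ) → S → A) (g : Agent Θ S A) : ℝ :=
  2 * pendingVisits ζ g - M.escape γ ζ act g

theorem escapePotential_mem_Icc [Fintype A] (M : MDPFamily Θ S A) {γ : ℝ} (hγ0 : 0 ≤ γ) (hγ1 : γ < 1)
    (ζ : S → A → ℕ) (act : (Θ → ℝ) → S → A) {g : Agent Θ S A} (hg : g.belief ∈ subbeliefs Θ) :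
    M.escapePotential γ ζ act g ∈ Set.Icc (0 : ℝ) (2 * ∑ s, ∑ a, (ζ s a + 1 : ℝ)) := by
  have h1 := M.escape_le_pendingVisits hγ0 hγ1 ζ act hg
  have h2 := (M.escape_mem_Icc hγ0 hγ1 ζ act hg).1
  have h3 : (pendingVisits ζ g : ℝ) ≤ ∑ s, ∑ a, (ζ s a + 1 : ℝ) := by
    have : pendingVisits ζ g ≤ ∑ s, ∑ a, (ζ s a + 1) :=
      Finset.sum_le_sum fun s _ => Finset.sum_le_sum fun a _ => Nat.sub_le _ _
    exact_mod_cast this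
  unfold escapePotential
  constructor <;> linarith

/-- At a settled state `escape` grows in mean by the factor `1 / γ` or more. At an unsettled state
it may fall by at most one, and losing one pending visit, counted twice, outweighs this. -/
theorem sum_meanT_mul_escapePotential_le [Fintype A] (M : MDPFamily Θ S A) {γ : ℝ} (hγ0 : 0 ≤ γ)
    (hγ1 : γ < 1) (ζ : S → A → ℕ) (act : (Θ → ℝ) → S → A) {g : Agent Θ S A}
    (hg : g.belief ∈ stdSimplex ℝ Θ) :
    ∑ s', M.meanT g.belief g.state (act g.belief g.state) s' *
        M.escapePotential γ ζ act (M.agentStep ζ g (act g.belief g.state) s') ≤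
      M.escapePotential γ ζ act g - (1 - γ) * M.escape γ ζ act g := by
  have hb := stdSimplex_subset_subbeliefs hg
  have hstep := fun s' => M.escape_mem_Icc hγ0 hγ1 ζ act
    (M.agentStep_belief_mem_subbeliefs ζ hb (act g.belief g.state) s')
  have hE := M.sum_meanT_mul_nonneg hb g.state (act g.belief g.state) fun s' => (hstep s').1
  have hW := M.escape_mem_Icc hγ0 hγ1 ζ act hb
  have hT : ∑ s', M.meanT g.belief g.state (act g.belief g.state) s' = 1 :=
    (M.sum_meanT _ _ _).trans hg.2
  have key : ∀ u : ℝ, (∀ s', (pendingVisits ζ (M.agentStep ζ g (act g.belief g.state) s') : ℝ) = u) →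
      ∑ s', M.meanT g.belief g.state (act g.belief g.state) s' *
        M.escapePotential γ ζ act (M.agentStep ζ g (act g.belief g.state) s') =
      2 * u - ∑ s', M.meanT g.belief g.state (act g.belief g.state) s' *
        M.escape γ ζ act (M.agentStep ζ g (act g.belief g.state) s') := by
    intro u hu
    simp only [escapePotential, hu, mul_sub, Finset.sum_sub_distrib]
    rw [← Finset.sum_mul, hT, one_mul]
  by_cases h : Settled ζ act g
  · rw [key (pendingVisits ζ g) fun s' => by rw [M.pendingVisits_agentStep_of_settled h],
      escapePotential]
    have h2 := M.escape_le_of_settled hγ0 hγ1 ζ act hb h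
    -- From `W ≤ γ E` it follows that `(2 - γ) W ≤ (1 - (1 - γ) ^ 2) E ≤ E`.
    nlinarith [mul_nonneg (sub_nonneg.2 h2) (by linarith : (0 : ℝ) ≤ 2 - γ),
      mul_nonneg (sq_nonneg (1 - γ)) hE]
  · rw [key (pendingVisits ζ g - 1) fun s' => by
      rw [← M.pendingVisits_agentStep_of_not_settled h s']; push_cast; ring, escapePotential]
    nlinarith [hW.1, hW.2, mul_nonneg hγ0 hW.1]

/-! ### Counting along runs -/

theorem agentAt_congr (M : MDPFamily Θ S A) (ζ : S → A → ℕ) (act : (Θ → ℝ) → S → A)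
    (b₀ : Θ → ℝ) {x y : ℕ → S} {t : ℕ} (h : ∀ k ≤ t, x k = y k) :
    M.agentAt ζ act b₀ x t = M.agentAt ζ act b₀ y t := by
  induction t with
  | zero => simp only [agentAt, h 0 le_rfl]
  | succ t ih => simp only [agentAt, ih fun k hk => h k (hk.trans t.le_succ), h (t + 1) le_rfl]

theorem agentAt_state (M : MDPFamily Θ S A) (ζ : S → A → ℕ) (act : (Θ → ℝ) → S → A)
    (b₀ : Θ → ℝ) (x : ℕ → S) (t : ℕ) : (M.agentAt ζ act b₀ x t).state = x t := by
  cases t <;> rfl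

theorem agentAt_belief_mem_subbeliefs (M : MDPFamily Θ S A) (ζ : S → A → ℕ)
    (act : (Θ → ℝ) → S → A) {b₀ : Θ → ℝ} (hb₀ : b₀ ∈ subbeliefs Θ) (x : ℕ → S) (t : ℕ) :
    (M.agentAt ζ act b₀ x t).belief ∈ subbeliefs Θ := by
  induction t with
  | zero => exact hb₀
  | succ t ih => exact M.agentStep_belief_mem_subbeliefs ζ ih _ _

open Classical in
/-- The number of times `k` with `t ≤ k < t + T` at which the algorithm's data satisfy `p`, when the
states encountered are `x 0, x 1, …`. -/
noncomputable def countAgents (M : MDPFamily Θ S A) (ζ : S → A → ℕ) (act : (Θ → ℝ) → S → A)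
    (b₀ : Θ → ℝ) (p : Agent Θ S A → Prop) (x : ℕ → S) (t T : ℕ) : ℕ :=
  ∑ j ∈ Finset.range T, if p (M.agentAt ζ act b₀ x (t + j)) then 1 else 0

open Classical in
theorem countAgents_succ (M : MDPFamily Θ S A) (ζ : S → A → ℕ) (act : (Θ → ℝ) → S → A)
    (b₀ : Θ → ℝ) (p : Agent Θ S A → Prop) (x : ℕ → S) (t T : ℕ) :
    M.countAgents ζ act b₀ p x t (T + 1) = M.countAgents ζ act b₀ p x (t + 1) T +
      if p (M.agentAt ζ act b₀ x t) then 1 else 0 := by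
  rw [countAgents, Finset.sum_range_succ', countAgents]
  congr 1
  exact Finset.sum_congr rfl fun j _ => by rw [add_right_comm t 1 j, add_assoc]

/-- Exponential Markov inequality: `(1 + η) ^ count * (D + Φ)` is a supermartingale, with `Φ` the
potential. At a time satisfying `p`, the mean of `D + Φ ≤ 2 * D` falls by at least `q ≥ η * (2 *
D)`, which pays for the factor `1 + η`. The shift by `D` keeps the final value bounded below.
Conditioning on the past is expressed by cylinder sets, with induction on the remaining horizon. -/
theorem measureReal_countAgents_mul_le [Fintype A] {Ω : Type*} [MeasurableSpace Ω]
    {M : MDPFamily Θ S A}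
    {γ : ℝ} (hγ0 : 0 ≤ γ) (hγ1 : γ < 1) {ζ : S → A → ℕ} {act : (Θ → ℝ) → S → A}
    {b₀ : Θ → ℝ} (hb₀ : b₀ ∈ stdSimplex ℝ Θ) {s₀ : S} {μ : Measure Ω} [IsFiniteMeasure μ]
    {X : ℕ → Ω → S} (hX : M.IsRun ζ act b₀ s₀ μ X) {p : Agent Θ S A → Prop} {q η D : ℝ}
    (hp : ∀ g, M.Supported b₀ ζ g.visits g.belief → p g → q ≤ (1 - γ) * M.escape γ ζ act g)
    (hη : 0 ≤ η) (hD : 2 * ∑ s, ∑ a, (ζ s a + 1 : ℝ) ≤ D) (hηD : η * (2 * D) ≤ q) (T : ℕ) :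
    ∀ (t : ℕ) (x : ℕ → S) (m : ℕ),
      M.Supported b₀ ζ (M.agentAt ζ act b₀ x t).visits (M.agentAt ζ act b₀ x t).belief →
      μ.real ({ω | ∀ k ≤ t, X k ω = x k} ∩
          {ω | m ≤ M.countAgents ζ act b₀ p (fun k => X k ω) t T}) * ((1 + η) ^ m * D) ≤
        μ.real {ω | ∀ k ≤ t, X k ω = x k} *
          (D + M.escapePotential γ ζ act (M.agentAt ζ act b₀ x t)) := by
  have hD0 : 0 ≤ D := le_trans (by positivity) hD
  have hq : 0 ≤ q := le_trans (by positivity) hηD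
  induction T with
  | zero =>
    intro t x m hg
    have hΦ := (M.escapePotential_mem_Icc hγ0 hγ1 ζ act
      (stdSimplex_subset_subbeliefs (hg.mem_stdSimplex hb₀))).1
    rcases m.eq_zero_or_pos with rfl | hm
    · rw [pow_zero, one_mul]
      exact mul_le_mul (measureReal_mono Set.inter_subset_left) (by linarith) hD0
        measureReal_nonneg
    · have : {ω | m ≤ M.countAgents ζ act b₀ p (fun k => X k ω) t 0} = ∅ := by
        ext ω
        simp only [countAgents, Finset.range_zero, Finset.sum_empty, Set.mem_ofPred_eq,
          Set.mem_empty_iff_false, iff_false]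
        omega
      rw [this, Set.inter_empty, measureReal_empty, zero_mul]
      exact mul_nonneg measureReal_nonneg (by linarith)
  | succ T ih =>
    intro t x m hg
    set g := M.agentAt ζ act b₀ x t with hgdef
    set a := act g.belief g.state with ha
    have hb := hg.mem_stdSimplex hb₀
    have hb' := stdSimplex_subset_subbeliefs hb
    have hΦ := M.escapePotential_mem_Icc hγ0 hγ1 ζ act hb'
    set C := {ω | ∀ k ≤ t, X k ω = x k} with hC
    have hC0 : 0 ≤ μ.real C := measureReal_nonneg
    have step : ∀ m', μ.real (C ∩ {ω | m' ≤ M.countAgents ζ act b₀ p (fun k => X k ω) (t + 1) T}) *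
        ((1 + η) ^ m' * D) ≤
        μ.real C * (D + M.escapePotential γ ζ act g - (1 - γ) * M.escape γ ζ act g) := by
      intro m'
      set E := {ω | m' ≤ M.countAgents ζ act b₀ p (fun k => X k ω) (t + 1) T} with hE
      have hpos : 0 ≤ (1 + η) ^ m' * D := by positivity
      -- The cylinder `C` is split according to the state at time `t + 1`.
      let y : S → ℕ → S := fun s' => Function.update x (t + 1) s'
      have hyx : ∀ s', ∀ k ≤ t, y s' k = x k := fun s' k hk =>
        Function.update_of_ne (by omega) _ _
      have hyt : ∀ s', y s' (t + 1) = s' := fun s' => Function.update_self _ _ _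
      have hyg : ∀ s', M.agentAt ζ act b₀ (y s') t = g := fun s' =>
        M.agentAt_congr ζ act b₀ (hyx s')
      have hyg' : ∀ s', M.agentAt ζ act b₀ (y s') (t + 1) = M.agentStep ζ g a s' := fun s' => by
        rw [agentAt, hyg, hyt]
      have hcover : C ∩ E ⊆ ⋃ s' ∈ Finset.univ, ({ω | ∀ k ≤ t + 1, X k ω = y s' k} ∩ E) := by
        rintro ω ⟨hω, hωE⟩
        simp only [Set.mem_iUnion]
        refine ⟨X (t + 1) ω, Finset.mem_univ _, fun k hk => ?_, hωE⟩
        rcases Nat.le_succ_iff.1 hk with hk | rfl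
        · rw [hyx _ k hk]
          exact hω k hk
        · exact (hyt _).symm
      have hlaw : ∀ s', μ.real {ω | ∀ k ≤ t + 1, X k ω = y s' k} =
          μ.real C * M.meanT g.belief g.state a s' := by
        intro s'
        rw [hX.law t (y s'), hyg, hyt, hyx s' t le_rfl]
        have hst : x t = g.state := (M.agentAt_state ζ act b₀ x t).symm
        rw [hst]
        congr 2
        ext ω
        exact forall₂_congr fun k hk => by rw [hyx s' k hk]
      calc _ ≤ (∑ s', μ.real ({ω | ∀ k ≤ t + 1, X k ω = y s' k} ∩ E)) * ((1 + η) ^ m' * D) :=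
            mul_le_mul_of_nonneg_right ((measureReal_mono hcover (measure_ne_top _ _)).trans
              (measureReal_biUnion_finset_le _ _)) hpos
        _ ≤ ∑ s', μ.real C * (M.meanT g.belief g.state a s' *
              (D + M.escapePotential γ ζ act (M.agentStep ζ g a s'))) := by
            rw [Finset.sum_mul]
            refine Finset.sum_le_sum fun s' _ => ?_
            rw [← mul_assoc (μ.real C), ← hlaw]
            -- For an impossible outcome the induction hypothesis is unavailable, but the cylinder
            -- is null.
            rcases (M.meanT_nonneg hb.1 g.state a s').eq_or_lt with h0 | h0
            · have hz : μ.real {ω | ∀ k ≤ t + 1, X k ω = y s' k} = 0 := by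
                rw [hlaw, ← h0, mul_zero]
              have hz' : μ.real ({ω | ∀ k ≤ t + 1, X k ω = y s' k} ∩ E) = 0 :=
                le_antisymm ((measureReal_mono Set.inter_subset_left).trans hz.le)
                  measureReal_nonneg
              rw [hz, hz', zero_mul, zero_mul]
            · have := ih (t + 1) (y s') m' (by rw [hyg']; exact hg.agentStep h0)
              rwa [hyg'] at this
        _ = μ.real C * (D + ∑ s', M.meanT g.belief g.state a s' *
              M.escapePotential γ ζ act (M.agentStep ζ g a s')) := by
            rw [← Finset.mul_sum]
            simp only [mul_add, Finset.sum_add_distrib]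
            rw [← Finset.sum_mul, (M.sum_meanT _ _ _).trans hb.2, one_mul]
        _ ≤ _ := by
            refine mul_le_mul_of_nonneg_left ?_ hC0
            have := M.sum_meanT_mul_escapePotential_le hγ0 hγ1 ζ act hb
            linarith
    have hcount : ∀ ω ∈ C, M.agentAt ζ act b₀ (fun k => X k ω) t = g := fun ω hω =>
      M.agentAt_congr ζ act b₀ hω
    have hW := (M.escape_mem_Icc hγ0 hγ1 ζ act hb').1
    by_cases hpg : p g
    · cases m with
      | zero =>
        rw [pow_zero, one_mul]
        exact mul_le_mul (measureReal_mono Set.inter_subset_left) (by linarith [hΦ.1]) hD0 hC0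
      | succ m =>
        have hsub : C ∩ {ω | m + 1 ≤ M.countAgents ζ act b₀ p (fun k => X k ω) t (T + 1)} ⊆
            C ∩ {ω | m ≤ M.countAgents ζ act b₀ p (fun k => X k ω) (t + 1) T} := by
          rintro ω ⟨hω, hm⟩
          refine ⟨hω, ?_⟩
          rw [Set.mem_ofPred_eq, countAgents_succ, hcount ω hω, if_pos hpg] at hm
          exact Nat.le_of_succ_le_succ hm
        have h1 : μ.real (C ∩ {ω | m + 1 ≤ M.countAgents ζ act b₀ p (fun k => X k ω) t (T + 1)}) *
            ((1 + η) ^ m * D) ≤ μ.real C * (D + M.escapePotential γ ζ act g - q) := by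
          refine ((mul_le_mul_of_nonneg_right (measureReal_mono hsub) (by positivity)).trans
            (step m)).trans (mul_le_mul_of_nonneg_left ?_ hC0)
          linarith [hp g hg hpg]
        have h2 : (1 + η) * (D + M.escapePotential γ ζ act g - q) ≤
            D + M.escapePotential γ ζ act g := by
          nlinarith [mul_le_mul_of_nonneg_left (hΦ.2.trans hD) hη, mul_nonneg hη hq]
        calc _ = (1 + η) * (μ.real (C ∩
              {ω | m + 1 ≤ M.countAgents ζ act b₀ p (fun k => X k ω) t (T + 1)}) *
              ((1 + η) ^ m * D)) := by ring
          _ ≤ (1 + η) * (μ.real C * (D + M.escapePotential γ ζ act g - q)) :=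
              mul_le_mul_of_nonneg_left h1 (by positivity)
          _ = μ.real C * ((1 + η) * (D + M.escapePotential γ ζ act g - q)) := by ring
          _ ≤ _ := mul_le_mul_of_nonneg_left h2 hC0
    · have hsub : C ∩ {ω | m ≤ M.countAgents ζ act b₀ p (fun k => X k ω) t (T + 1)} ⊆
          C ∩ {ω | m ≤ M.countAgents ζ act b₀ p (fun k => X k ω) (t + 1) T} := by
        rintro ω ⟨hω, hm⟩
        refine ⟨hω, ?_⟩
        rwa [Set.mem_ofPred_eq, countAgents_succ, hcount ω hω, if_neg hpg] at hm
      refine ((mul_le_mul_of_nonneg_right (measureReal_mono hsub) (by positivity)).trans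
        (step m)).trans (mul_le_mul_of_nonneg_left ?_ hC0)
      linarith [mul_nonneg (sub_nonneg.2 hγ1.le) hW]

theorem measureReal_exists_countAgents_le [Fintype A] {Ω : Type*} [MeasurableSpace Ω]
    {M : MDPFamily Θ S A}
    {γ : ℝ} (hγ0 : 0 ≤ γ) (hγ1 : γ < 1) {ζ : S → A → ℕ} {act : (Θ → ℝ) → S → A}
    {b₀ : Θ → ℝ} (hb₀ : b₀ ∈ stdSimplex ℝ Θ) {s₀ : S} {μ : Measure Ω} [IsProbabilityMeasure μ]
    {X : ℕ → Ω → S} (hX : M.IsRun ζ act b₀ s₀ μ X) {p : Agent Θ S A → Prop} {q η D : ℝ}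
    (hp : ∀ g, M.Supported b₀ ζ g.visits g.belief → p g → q ≤ (1 - γ) * M.escape γ ζ act g)
    (hη : 0 ≤ η) (hD : 2 * ∑ s, ∑ a, (ζ s a + 1 : ℝ) ≤ D) (hD0 : 0 < D)
    (hηD : η * (2 * D) ≤ q) (m : ℕ) :
    μ.real {ω | ∃ T, m ≤ M.countAgents ζ act b₀ p (fun k => X k ω) 0 T} ≤ 2 / (1 + η) ^ m := by
  have hfin : ∀ T, μ.real {ω | m ≤ M.countAgents ζ act b₀ p (fun k => X k ω) 0 T} ≤
      2 / (1 + η) ^ m := by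
    intro T
    have hsup : M.Supported b₀ ζ (M.agentAt ζ act b₀ (fun _ => s₀) 0).visits
        (M.agentAt ζ act b₀ (fun _ => s₀) 0).belief := ⟨_, .start, fun _ _ => min_le_left _ _⟩
    have h1 := measureReal_countAgents_mul_le hγ0 hγ1 hb₀ hX hp hη hD hηD T 0 (fun _ => s₀) m hsup
    have h2 := (M.escapePotential_mem_Icc hγ0 hγ1 ζ act
      (stdSimplex_subset_subbeliefs (hsup.mem_stdSimplex hb₀))).2.trans hD
    have h3 : μ.real {ω | m ≤ M.countAgents ζ act b₀ p (fun k => X k ω) 0 T} =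
        μ.real ({ω | ∀ k ≤ 0, X k ω = s₀} ∩
          {ω | m ≤ M.countAgents ζ act b₀ p (fun k => X k ω) 0 T}) := by
      refine measureReal_congr ?_
      filter_upwards [hX.start] with ω hω
      refine propext ⟨fun h => ⟨fun k hk => ?_, h⟩, fun h => h.2⟩
      rw [Nat.le_zero.1 hk, hω]
    have h4 : μ.real {ω | ∀ k ≤ 0, X k ω = s₀} *
        (D + M.escapePotential γ ζ act (M.agentAt ζ act b₀ (fun _ => s₀) 0)) ≤ 2 * D := by
      rw [two_mul]
      refine (mul_le_mul_of_nonneg_left (add_le_add le_rfl h2) measureReal_nonneg).trans ?_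
      exact mul_le_of_le_one_left (by positivity) measureReal_le_one
    rw [h3, le_div_iff₀ (by positivity)]
    refine le_of_mul_le_mul_right ?_ hD0
    rw [mul_assoc]
    exact h1.trans h4
  have hmono : Monotone fun T => {ω | m ≤ M.countAgents ζ act b₀ p (fun k => X k ω) 0 T} := by
    intro T T' hT ω hω
    exact le_trans (Set.mem_ofPred_eq.mp hω)
      (Finset.sum_le_sum_of_subset (Finset.range_mono hT))
  -- The bound is uniform in the horizon, and the events increase with it.
  rw [Set.ofPred_exists, Measure.real, hmono.measure_iUnion]
  refine ENNReal.toReal_le_of_le_ofReal (by positivity) (iSup_le fun T => ?_)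
  rw [← ofReal_measureReal]
  exact ENNReal.ofReal_le_ofReal (hfin T)

open Classical in
theorem exists_le_countAgents (M : MDPFamily Θ S A) (ζ : S → A → ℕ) (act : (Θ → ℝ) → S → A)
    (b₀ : Θ → ℝ) (p : Agent Θ S A → Prop) (x : ℕ → S) (F : Finset ℕ)
    (hF : ∀ t ∈ F, p (M.agentAt ζ act b₀ x t)) :
    ∃ T, F.card ≤ M.countAgents ζ act b₀ p x 0 T := by
  refine ⟨F.sup id + 1, ?_⟩
  simp only [countAgents, zero_add]
  rw [← Finset.card_filter]
  refine Finset.card_le_card fun t ht => ?_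
  rw [Finset.mem_filter, Finset.mem_range, Nat.lt_succ_iff]
  exact ⟨Finset.le_sup (f := id) ht, hF t ht⟩

theorem badTimes_eq_empty [Finite A] [Nonempty A] (M : MDPFamily Θ S A)
    (hR : ∀ θ s a, M.R θ s a ∈ Set.Icc (0 : ℝ) 1) {γ ε : ℝ} (hγ0 : 0 ≤ γ) (hγ1 : γ < 1)
    (hε : 1 ≤ 4 * (ε * (1 - γ))) (ζ : S → A → ℕ) (act : (Θ → ℝ) → S → A) {b₀ : Θ → ℝ}
    (hb₀ : b₀ ∈ stdSimplex ℝ Θ) (x : ℕ → S) : M.badTimes γ ε ζ act b₀ x = ∅ := by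
  refine Set.eq_empty_of_forall_notMem fun t ht => ht ?_
  have h1 : 0 < 1 - γ := by linarith
  have hb := M.agentAt_belief_mem_subbeliefs ζ act (stdSimplex_subset_subbeliefs hb₀) x t
  have h2 : M.bayesOptValue γ (M.agentAt ζ act b₀ x t).belief (x t) ≤ 1 / (1 - γ) :=
    ciSup_le fun n => (M.bayes_optValueN_mem_Icc hR hγ0 hγ1 n hb (x t)).2
  have h3 : 0 ≤ M.algValue γ ζ act (M.agentAt ζ act b₀ x t) :=
    Real.iSup_nonneg fun n => (M.eval_policyValueN_mem_Icc hR hγ0 hγ1 ζ _ n hb).1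
  have h4 : 1 / (1 - γ) ≤ 4 * ε := by
    rw [div_le_iff₀ h1]
    linarith
  linarith

end MDPFamily

/-! ### Choice of constants and conclusion -/

theorem two_div_one_add_pow_le {η δ : ℝ} {m : ℕ} (hη0 : 0 ≤ η) (hη1 : η ≤ 1) (hδ0 : 0 < δ)
    (hδ : δ ≤ 1 / 2) (hm : 4 * Real.log (1 / δ) ≤ η * m) : 2 / (1 + η) ^ m ≤ δ := by
  have h1 : 0 < 1 + η := by linarith
  have h2 : η / 2 ≤ Real.log (1 + η) := by
    refine le_trans ?_ (Real.one_sub_inv_le_log_of_pos h1)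
    have : 1 - (1 + η)⁻¹ = η / (1 + η) := by field_simp; ring
    rw [this]
    gcongr
    linarith
  have h3 : Real.log 2 ≤ Real.log (1 / δ) :=
    Real.log_le_log two_pos (by rw [le_div_iff₀ hδ0]; linarith)
  have h4 : Real.log (2 / δ) ≤ Real.log ((1 + η) ^ m) := by
    rw [Real.log_pow, div_eq_mul_one_div, Real.log_mul two_ne_zero (by positivity)]
    have := mul_le_mul_of_nonneg_left h2 (Nat.cast_nonneg (α := ℝ) m)
    linarith
  have h5 := (Real.log_le_log_iff (by positivity) (by positivity)).1 h4
  rw [div_le_iff₀ hδ0] at h5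
  rw [div_le_iff₀ (by positivity)]
  linarith

theorem theorem2 :
    ∃ C K : ℝ, 0 < C ∧ 0 < K ∧
      ∀ (Θ S A Ω : Type*) [Fintype Θ] [Fintype S] [Fintype A] [DecidableEq S] [DecidableEq A]
        [MeasurableSpace Ω] (M : MDPFamily Θ S A) (γ β ε δ : ℝ) (b₀ : Θ → ℝ) (s₀ : S)
        (ζ : S → A → ℕ) (act : (Θ → ℝ) → S → A) (μ : Measure Ω) [IsProbabilityMeasure μ]
        (X : ℕ → Ω → S),
        (∀ θ s a, M.R θ s a ∈ Set.Icc (0 : ℝ) 1) →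
        0 ≤ γ → γ < 1 →
        0 < ε → ε * (1 - γ) < 1 →
        0 < δ → δ ≤ 1 / 2 →
        b₀ ∈ stdSimplex ℝ Θ →
        C * ((Fintype.card S : ℝ) ^ 2 * (Fintype.card A : ℝ) / (1 - γ) ^ 2) ≤ β →
        M.BonusMonotone β b₀ →
        M.IsSampleComplexity β (ε * (1 - γ)) b₀ ζ →
        (∀ s a, 1 ≤ ζ s a) →
        M.IsGreedy γ β act →
        M.IsRun ζ act b₀ s₀ μ X →
        1 - δ ≤ μ.real {ω |
          (M.badTimes γ ε ζ act b₀ (fun t => X t ω)).Finite ∧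
          ((M.badTimes γ ε ζ act b₀ (fun t => X t ω)).ncard : ℝ) ≤
            K * ((∑ s, ∑ a, (ζ s a : ℝ)) / (ε * (1 - γ) ^ 3) *
              Real.log (1 / δ) * Real.log (1 / (ε * (1 - γ))))} := by
  refine ⟨1, 32, one_pos, by norm_num, ?_⟩
  intro Θ S A Ω _ _ _ _ _ _ M γ β ε δ b₀ s₀ ζ act μ _ X hR hγ0 hγ1 hε hεγ hδ0 hδ hb₀ hβ _ hζ hζ1
    hact hX
  have h1 : 0 < 1 - γ := by linarith
  have : Nonempty S := ⟨s₀⟩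
  have : Nonempty A := ⟨act b₀ s₀⟩
  have hlogδ : 0 ≤ Real.log (1 / δ) := Real.log_nonneg (by rw [le_div_iff₀ hδ0]; linarith)
  have hlogε : 0 ≤ Real.log (1 / (ε * (1 - γ))) :=
    Real.log_nonneg (by rw [le_div_iff₀ (by positivity)]; linarith)
  -- If `4 * ε` exceeds the range `1 / (1 - γ)` of the values, no time is bad. Otherwise `ε * (1 -
  -- γ) < 1 / 4`, which makes the last logarithm at least one.
  rcases le_or_gt 1 (4 * (ε * (1 - γ))) with hbig | hsmall
  · simp only [M.badTimes_eq_empty hR hγ0 hγ1 hbig ζ act hb₀, Set.finite_empty, Set.ncard_empty,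
      Nat.cast_zero, true_and]
    have hnn : 0 ≤ 32 * ((∑ s, ∑ a, (ζ s a : ℝ)) / (ε * (1 - γ) ^ 3) * Real.log (1 / δ) *
        Real.log (1 / (ε * (1 - γ)))) := by positivity
    simp only [hnn, Set.ofPred_true, probReal_univ]
    linarith
  have hβ' : 1 / (1 - γ) ^ 2 ≤ β := by
    refine le_trans ?_ hβ
    rw [one_mul]
    have hS : (1 : ℝ) ≤ Fintype.card S := by exact_mod_cast Fintype.card_pos
    have hA : (1 : ℝ) ≤ Fintype.card A := by exact_mod_cast Fintype.card_pos
    gcongr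
    exact one_le_mul_of_one_le_of_one_le (one_le_pow₀ hS) hA
  set Z : ℝ := ∑ s, ∑ a, (ζ s a : ℝ) with hZ
  have hZ1 : ∀ s a, (1 : ℝ) ≤ ζ s a := fun s a => by exact_mod_cast hζ1 s a
  have hD : 2 * ∑ s, ∑ a, (ζ s a + 1 : ℝ) ≤ 4 * Z := by
    have : ∑ s, ∑ a, (ζ s a + 1 : ℝ) ≤ ∑ s, ∑ a, 2 * (ζ s a : ℝ) :=
      Finset.sum_le_sum fun s _ => Finset.sum_le_sum fun a _ => by linarith [hZ1 s a]
    simp only [← Finset.mul_sum] at this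
    linarith
  have hZpos : 1 ≤ Z := by
    refine (hZ1 s₀ (act b₀ s₀)).trans ?_
    refine (Finset.single_le_sum (f := fun a => (ζ s₀ a : ℝ)) (fun _ _ => by positivity)
      (Finset.mem_univ _)).trans ?_
    exact Finset.single_le_sum (f := fun s => ∑ a, (ζ s a : ℝ))
      (fun _ _ => Finset.sum_nonneg fun _ _ => by positivity) (Finset.mem_univ s₀)
  set q : ℝ := ε * (1 - γ) ^ 3 with hq
  have hq0 : 0 < q := by positivity
  have hq1 : q ≤ 1 := by
    have : q = ε * (1 - γ) * (1 - γ) ^ 2 := by rw [hq]; ring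
    rw [this]
    exact mul_le_one₀ hεγ.le (by positivity) (pow_le_one₀ h1.le (by linarith))
  set L : ℝ := 32 * (Z / q * Real.log (1 / δ) * Real.log (1 / (ε * (1 - γ)))) with hL
  let p : MDPFamily.Agent Θ S A → Prop := fun g =>
    ¬ M.bayesOptValue γ g.belief g.state - 4 * ε ≤ M.algValue γ ζ act g
  have hp : ∀ g, M.Supported b₀ ζ g.visits g.belief → p g →
      q ≤ (1 - γ) * M.escape γ ζ act g := by
    intro g hg hpg
    have h2 := M.bayesOptValue_le_algValue_add_escape hR hγ0 hγ1 hβ' hε.le hb₀ hζ hact hg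
    have h3 : 2 * ε ≤ 2 / (1 - γ) ^ 2 * M.escape γ ζ act g := by
      have := not_le.1 hpg
      linarith
    rw [div_mul_eq_mul_div, le_div_iff₀ (by positivity)] at h3
    have h4 := mul_le_mul_of_nonneg_left h3 h1.le
    rw [hq]
    linarith
  -- With `D = 4 * Z`, the choice `η = q / (8 * Z)` gives `η * (2 * D) = q`.
  have htail := MDPFamily.measureReal_exists_countAgents_le hγ0 hγ1 hb₀ hX hp
    (η := q / (8 * Z)) (by positivity) hD (by positivity)
    (by rw [div_mul_eq_mul_div, div_le_iff₀ (by positivity)]; linarith) (⌊L⌋₊ + 1)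
  have hδ' : 2 / (1 + q / (8 * Z)) ^ (⌊L⌋₊ + 1) ≤ δ := by
    refine two_div_one_add_pow_le (by positivity) ?_ hδ0 hδ ?_
    · rw [div_le_one (by positivity)]
      linarith
    · have h2 : 1 ≤ Real.log (1 / (ε * (1 - γ))) := by
        rw [Real.le_log_iff_exp_le (by positivity), le_div_iff₀ (by positivity)]
        have h3 : 0 < ε * (1 - γ) := by positivity
        nlinarith [Real.exp_one_lt_d9]
      have h3 : 32 * (Z / q * Real.log (1 / δ)) ≤ L := by
        rw [hL]
        exact mul_le_mul_of_nonneg_left (le_mul_of_one_le_right (by positivity) h2) (by norm_num)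
      have h4 : L ≤ ((⌊L⌋₊ + 1 : ℕ) : ℝ) := by
        push_cast
        exact (Nat.lt_floor_add_one L).le
      -- The constant `32` is `4` from the tail estimate times `8` from `η`.
      calc 4 * Real.log (1 / δ) = q / (8 * Z) * (32 * (Z / q * Real.log (1 / δ))) := by
            field_simp
            ring
        _ ≤ _ := mul_le_mul_of_nonneg_left (h3.trans h4) (by positivity)
  set G := {ω | (M.badTimes γ ε ζ act b₀ (fun t => X t ω)).Finite ∧
    ((M.badTimes γ ε ζ act b₀ (fun t => X t ω)).ncard : ℝ) ≤ L} with hG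
  have hcover : Set.univ ⊆ G ∪
      {ω | ∃ T, ⌊L⌋₊ + 1 ≤ M.countAgents ζ act b₀ p (fun k => X k ω) 0 T} := by
    intro ω _
    by_cases hω : ω ∈ G
    · exact Or.inl hω
    right
    -- A finite set of bad times covers both ways of failing: infinitely many bad times, or finitely
    -- many but more than `L`.
    obtain ⟨F, hF, hcard⟩ : ∃ F : Finset ℕ,
        (F : Set ℕ) ⊆ M.badTimes γ ε ζ act b₀ (fun t => X t ω) ∧ ⌊L⌋₊ + 1 ≤ F.card := by
      by_cases hfin : (M.badTimes γ ε ζ act b₀ (fun t => X t ω)).Finite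
      · refine ⟨hfin.toFinset, by simp, ?_⟩
        rw [← Set.ncard_eq_toFinset_card _ hfin]
        refine Nat.succ_le_of_lt ((Nat.floor_lt (by positivity)).2 ?_)
        exact not_le.1 fun h => hω ⟨hfin, h⟩
      · obtain ⟨F, hF, hc⟩ := Set.Infinite.exists_subset_card_eq hfin (⌊L⌋₊ + 1)
        exact ⟨F, hF, hc.ge⟩
    obtain ⟨T, hT⟩ := M.exists_le_countAgents ζ act b₀ p (fun t => X t ω) F fun t ht => by
      have := hF ht
      simp only [MDPFamily.badTimes, Set.mem_ofPred_eq] at this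
      simpa only [p, MDPFamily.agentAt_state] using this
    exact ⟨T, hcard.trans hT⟩
  have hone : 1 ≤ μ.real G +
      μ.real {ω | ∃ T, ⌊L⌋₊ + 1 ≤ M.countAgents ζ act b₀ p (fun k => X k ω) 0 T} := by
    rw [← probReal_univ (μ := μ)]
    exact (measureReal_mono hcover).trans (measureReal_union_le _ _)
  linarith
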